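/- Let $Y$ be a closed smooth manifold and let $\mathcal F_t$, $t\in[0,1]$, be a path of nonsingular smooth codimension one foliations of $Y$. Let $L$ be a smooth line field on $Y$ transverse to $\mathcal F_0$. Suppose that $\mathcal F_t=\ker\lambda_t$, where $\lambda_t=\lambda+\beta_t$ is a path of nowhere vanishing smooth one-forms such that $\beta_t$ depends smoothly on $(t,y)\in[0,1]\times Y$, $\beta_0=0$, and $\beta_t(L)=0$ for all $t$. (A $C^0$-small smooth homotopy of a foliation $\mathcal F_0=\ker\lambda$ always has such defining forms, since each $\mathcal F_t$ is then transverse to $L$; no further smallness is needed.) For each $t$ let $\Omega^\bullet(\mathcal F_t)=\Gamma(\wedge^\bullet T^*\mathcal F_t)$ be the tangential forms with the leafwise differential $d_{\mathcal F_t}$, let $\pi_t$ denote restriction of forms to $T\mathcal F_t$, and let $\delta_t=\pi_t(\mu_t)\in\Omega^1(\mathcal F_t)$, where $\mu_t$ is a one-form with $d\lambda_t=\mu_t\wedge\lambda_t$ ($\delta_t$ is uniquely determined by $\lambda_t$). Let $H^\bullet_{tw}(\mathcal F_t)$ be the cohomology of $\Omega^\bullet(\mathcal F_t)$ with respect to the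 twisted differential $d_{\mathcal F_t}^{\lambda_t}\omega=d_{\mathcal F_t}\omega-\delta_t\wedge\omega$, and write $\dot\lambda_t=\dot\beta_t$ for the $t$-derivative. Suppose that $[\dot\lambda_t]=0$ in $H^1_{tw}(\mathcal F_t)$ for all $t\in[0,1]$, with primitives depending smoothly on $t$; that is, there is a smooth function $H$ on $[0,1]\times Y$, $H_t=H(t,\cdot)$, with $$\pi_t(\dot\lambda_t)=d_{\mathcal F_t}^{\lambda_t}H_t=d_{\mathcal F_t}H_t-H_t\,\delta_t\quad\text{for all }t\in[0,1].$$ Then $\mathcal F_t$ is an isotopy of foliations: there are diffeomorphisms $\phi_t:Y\to Y$, depending smoothly on $t\in[0,1]$, with $\phi_0=\mathrm{id}$ and $\phi_t^*(\mathcal F_t)=\mathcal F_0$ for all $t\in[0,1]$. -/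

import Mathlib

open Set
open scoped Manifold ContDiff Bundle

section Foliations

variable (E : Type*) [NormedAddCommGroup E] [NormedSpace ℝ E]
  (Y : Type*) [TopologicalSpace Y] [ChartedSpace E Y]

/-- A (not necessarily smooth) one-form on `Y`. -/
abbrev OneForm : Type _ := (y : Y) → (TangentSpace 𝓘(ℝ, E) y →L[ℝ] ℝ)

/-- A (not necessarily smooth) vector field on `Y`. -/
abbrev VecField : Type _ := (y : Y) → TangentSpace 𝓘(ℝ, E) y

/-- A field of linear subspaces of the tangent spaces of `Y`. -/
abbrev PlaneField : Type _ := (y : Y) → Submodule ℝ (TangentSpace 𝓘(ℝ, E) y)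

variable {E Y}

/-- The derivative `w(f)` of a function `f` at `y` in the direction of the tangent vector `w`. -/
noncomputable def dirDeriv (f : Y → ℝ) (y : Y) (w : TangentSpace 𝓘(ℝ, E) y) : ℝ :=
  mfderiv 𝓘(ℝ, E) 𝓘(ℝ, ℝ) f y w

/-- The kernel of a one-form. -/
noncomputable def OneForm.kerField (lam : OneForm E Y) : PlaneField E Y :=
  fun y => LinearMap.ker (lam y : TangentSpace 𝓘(ℝ, E) y →ₗ[ℝ] ℝ)

/-- The value `dλ(X, Z)` of the exterior derivative, by Cartan's formula
`dλ(X, Z) = X(λ(Z)) - Z(λ(X)) - λ([X, Z])`. -/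
noncomputable def OneForm.dApply (lam : OneForm E Y) (X Z : VecField E Y) (y : Y) : ℝ :=
  dirDeriv (fun z => lam z (Z z)) y (X y) - dirDeriv (fun z => lam z (X z)) y (Z y)
    - lam y (VectorField.mlieBracket 𝓘(ℝ, E) X Z y)

variable [IsManifold 𝓘(ℝ, E) ∞ Y]

/-- Smoothness of a vector field on a set: it is smooth as a section of the tangent bundle. -/
def VecField.SmoothOn (X : VecField E Y) (U : Set Y) : Prop :=
  ContMDiffOn 𝓘(ℝ, E) 𝓘(ℝ, E).tangent ∞
    (fun y => (Bundle.TotalSpace.mk' E y (X y) : TangentBundle 𝓘(ℝ, E) Y)) U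

/-- Involutivity: the Lie bracket of local smooth sections is again a section. -/
def PlaneField.Involutive (F : PlaneField E Y) : Prop :=
  ∀ (U : Set Y) (X Z : VecField E Y), IsOpen U → X.SmoothOn U → Z.SmoothOn U →
    (∀ y ∈ U, X y ∈ F y) → (∀ y ∈ U, Z y ∈ F y) →
    ∀ y ∈ U, VectorField.mlieBracket 𝓘(ℝ, E) X Z y ∈ F y

/-- A smooth line field: locally spanned by a nowhere vanishing smooth vector field. -/
def PlaneField.IsSmoothLineField (L : PlaneField E Y) : Prop :=
  ∀ y, ∃ U : Set Y, IsOpen U ∧ y ∈ U ∧ ∃ X : VecField E Y, X.SmoothOn U ∧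
    ∀ z ∈ U, X z ≠ 0 ∧ L z = Submodule.span ℝ {X z}

/-- Smoothness of a one-form on a set: it is smooth as a section of the cotangent bundle. -/
def OneForm.SmoothOn (lam : OneForm E Y) (U : Set Y) : Prop :=
  ContMDiffOn 𝓘(ℝ, E) (𝓘(ℝ, E).prod 𝓘(ℝ, E →L[ℝ] ℝ)) ∞
    (fun y => Bundle.TotalSpace.mk' (E →L[ℝ] ℝ)
      (E := fun y : Y => (TangentSpace 𝓘(ℝ, E) y →L[ℝ] ℝ)) y (lam y)) U

/-- A path of one-forms `β t`, `t ∈ [0, 1]`, that is smooth on `[0, 1] × Y`. -/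
def OneForm.SmoothPath (β : ℝ → OneForm E Y) : Prop :=
  ContMDiffOn (𝓘(ℝ, ℝ).prod 𝓘(ℝ, E)) (𝓘(ℝ, E).prod 𝓘(ℝ, E →L[ℝ] ℝ)) ∞
    (fun p : ℝ × Y => Bundle.TotalSpace.mk' (E →L[ℝ] ℝ)
      (E := fun y : Y => (TangentSpace 𝓘(ℝ, E) y →L[ℝ] ℝ)) p.2 (β p.1 p.2))
    (Icc (0 : ℝ) 1 ×ˢ univ)

/-- A nonsingular smooth codimension one foliation, given by its tangent distribution: a field of
hyperplanes that is locally the kernel of a nowhere vanishing smooth one-form and is involutive. -/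
structure PlaneField.IsCodimOneFoliation (F : PlaneField E Y) : Prop where
  smooth : ∀ y, ∃ U : Set Y, IsOpen U ∧ y ∈ U ∧ ∃ θ : OneForm E Y, θ.SmoothOn U ∧
    ∀ z ∈ U, θ z ≠ 0 ∧ F z = θ.kerField z
  involutive : F.Involutive

/-- `lam` is a defining one-form of `F`: it is smooth, vanishes nowhere, and `F = ker lam`. -/
structure OneForm.Defines (lam : OneForm E Y) (F : PlaneField E Y) : Prop where
  smooth : lam.SmoothOn univ
  ne_zero : ∀ y, lam y ≠ 0
  ker_eq : ∀ y, F y = lam.kerField y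

/-- `dλ = μ ∧ λ`, for a smooth one-form `μ`. -/
def OneForm.IsTwistingForm (lam μ : OneForm E Y) : Prop :=
  μ.SmoothOn univ ∧
  ∀ (U : Set Y) (X Z : VecField E Y), IsOpen U → X.SmoothOn U → Z.SmoothOn U →
    ∀ y ∈ U, lam.dApply X Z y = μ y (X y) * lam y (Z y) - μ y (Z y) * lam y (X y)

/-- For a foliation `F` with defining one-form `lam`, a function `h` and a one-form `σ`:
`d_F h - h π(μ) = π(σ)` as tangential one-forms (sections of `T*F`), where `dλ = μ ∧ λ` and `π` is
the restriction to `F`. The left side is the twisted tangential differential of `h`; `π(μ)` does not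
depend on the choice of `μ`. So a smooth such `h` exhibits `π(σ)` as a coboundary in
degree one of the twisted tangential complex, that is, `[σ] = 0` in `H¹_tw(F)`. -/
def OneForm.IsTwistedPrimitive (lam : OneForm E Y) (F : PlaneField E Y) (h : Y → ℝ)
    (σ : (y : Y) → TangentSpace 𝓘(ℝ, E) y → ℝ) : Prop :=
  ∃ μ : OneForm E Y, lam.IsTwistingForm μ ∧
    ∀ y, ∀ w ∈ F y, dirDeriv h y w - h y * μ y w = σ y w

/-- The derivative in `t ∈ [0, 1]` of a path of one-forms (one-sided at the end points). -/
noncomputable def OneForm.tDeriv (β : ℝ → OneForm E Y) (t : ℝ) :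
    (y : Y) → TangentSpace 𝓘(ℝ, E) y → ℝ :=
  fun y w => derivWithin (fun s => β s y w) (Icc (0 : ℝ) 1) t

/-- A function `H t y` that is smooth on `[0, 1] × Y`. -/
def SmoothTimeFunction (E : Type*) [NormedAddCommGroup E] [NormedSpace ℝ E]
    {Y : Type*} [TopologicalSpace Y] [ChartedSpace E Y] (H : ℝ → Y → ℝ) : Prop :=
  ContMDiffOn (𝓘(ℝ, ℝ).prod 𝓘(ℝ, E)) 𝓘(ℝ, ℝ) ∞
    (fun p : ℝ × Y => H p.1 p.2) (Icc (0 : ℝ) 1 ×ˢ univ)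

/-- The path `F t`, `t ∈ [0, 1]`, is an isotopy of foliations: there is a smooth isotopy `φ t` of
`Y`, starting at the identity, with `(φ t)^* (F t) = F 0` for all `t ∈ [0, 1]`. -/
def IsIsotopyOfFoliations (F : ℝ → PlaneField E Y) : Prop :=
  ∃ φ : ℝ → Diffeomorph 𝓘(ℝ, E) 𝓘(ℝ, E) Y Y ∞,
    ContMDiffOn (𝓘(ℝ, ℝ).prod 𝓘(ℝ, E)) 𝓘(ℝ, E) ∞
      (fun p : ℝ × Y => φ p.1 p.2) (Icc (0 : ℝ) 1 ×ˢ univ) ∧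
    (∀ y, φ 0 y = y) ∧
    ∀ t ∈ Icc (0 : ℝ) 1, ∀ y : Y,
      (F t (φ t y)).comap
        (mfderiv 𝓘(ℝ, E) 𝓘(ℝ, E) (φ t) y :
          TangentSpace 𝓘(ℝ, E) y →ₗ[ℝ] TangentSpace 𝓘(ℝ, E) (φ t y)) = F 0 y

end Foliations

/-! Moser's trick along the line field `L`. Let `R` be the section of `L` with `λ(R) = 1`. Since
`β_t` vanishes on `L`, `λ_t(R) = 1` for all `t`, so `λ̇_t(R) = 0`. Let `φ_t` be the flow of the
time-dependent field `-H_t R`. By Cartan's formula `d/dt φ_t^* λ_t = φ_t^* (λ̇_t - dH_t - H_t i_R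
dλ_t)`. From `dλ_t = μ_t ∧ λ_t` one gets `i_R dλ_t = μ_t(R) λ_t - μ_t`. On `ker λ_t` the bracket is
therefore `λ̇_t - (dH_t - H_t μ_t)`, which is zero by hypothesis, and on `R` it is `-dH_t(R)`. Hence
the bracket equals `-dH_t(R) λ_t` (`OneForm.IsTwistedPrimitive.deriv_eq`). For each tangent vector
`w` the function `u(t) = (φ_t^* λ_t)(w)` thus solves `u' = g u` with bounded `g`
(`IsSmoothFlow.hasDerivAt_pullbackPath`), so it vanishes at time `t` if and only if it vanishes at
time `0` (`eq_zero_iff_of_hasDerivAt_mul`). This says `φ_t^* F_t = F_0`.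

The flow of `-H_t R` needs no general theory of time-dependent fields. The field is a multiple of
the fixed field `R`, so `φ_t(y) = Φ_τ(y)`, where `Φ` is the flow of `R`, global because `Y` is
compact, and `τ = τ(t, y)` solves the scalar equation `τ' = -H_t(Φ_τ(y))`, `τ(0) = 0`, whose right
side is bounded. Smoothness of both `Φ` and `τ` comes from smooth dependence of solutions on time
and parameters (`IsODEFamily.contDiffOn`): Grönwall gives one derivative in the parameter, and the
derivative solves the linearised equation, which starts an induction. -/

/-! ### Grönwall estimates, linear equations and uniformity over compact time -/

section ParametricODE

open Filter Topology Function

variable {X : Type*} [NormedAddCommGroup X] [NormedSpace ℝ X]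

/-- Grönwall's inequality on `[0, 1]`, with zero initial value. -/
theorem norm_le_mul_gronwallBound {z z' : ℝ → X} {K ε : ℝ} (hK : 0 ≤ K) (hε : 0 ≤ ε)
    (hz : ∀ t ∈ Icc (0 : ℝ) 1, HasDerivWithinAt z (z' t) (Icc 0 1) t) (h0 : z 0 = 0)
    (hb : ∀ t ∈ Icc (0 : ℝ) 1, ‖z' t‖ ≤ K * ‖z t‖ + ε) :
    ∀ t ∈ Icc (0 : ℝ) 1, ‖z t‖ ≤ ε * gronwallBound 0 K 1 1 := by
  intro t ht
  have h1 := norm_le_gronwallBound_of_norm_deriv_right_le (f := z) (f' := z') (δ := 0) (K := K)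
    (ε := ε) (a := 0) (b := 1) (fun t ht => (hz t ht).continuousWithinAt)
    (fun t ht => (hz t ⟨ht.1, ht.2.le⟩).mono_of_mem_nhdsWithin
      (Icc_mem_nhdsGE_of_mem ht)) (by simp [h0])
    (fun t ht => hb t ⟨ht.1, ht.2.le⟩) t ht
  -- With zero initial value the bound is linear in `ε`. Pulling `ε` out is what later turns
  -- Grönwall into little-o estimates.
  have h2 : gronwallBound 0 K ε 1 = ε * gronwallBound 0 K 1 1 := by
    rcases eq_or_ne K 0 with rfl | h
    · simp [gronwallBound_K0]
    · simp only [gronwallBound_of_K_ne_0 h]; ring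
  refine h1.trans (h2 ▸ gronwallBound_mono le_rfl hε hK ?_)
  linarith [ht.2]

theorem gronwallBound_zero_one_nonneg {K : ℝ} (hK : 0 ≤ K) : 0 ≤ gronwallBound 0 K 1 1 := by
  have := gronwallBound_mono le_rfl zero_le_one hK (zero_le_one : (0 : ℝ) ≤ 1)
  rwa [gronwallBound_x0] at this

theorem abs_truncation_sub_le (a b : ℝ) :
    |max 0 (min 1 a) - max 0 (min 1 b)| ≤ |a - b| := by
  grind

/-- Linear differential equations on `[0, 1]` have a global solution. -/
theorem exists_linear_ode_solution [CompleteSpace X] {A : ℝ → X →L[ℝ] X} {B : ℝ → X}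
    (hA : ContinuousOn A (Icc 0 1)) (hB : ContinuousOn B (Icc 0 1)) :
    ∃ w : ℝ → X, w 0 = 0 ∧
      ∀ t ∈ Icc (0 : ℝ) 1, HasDerivWithinAt w (A t (w t) + B t) (Icc 0 1) t := by
  obtain ⟨M, hM⟩ := isCompact_Icc.exists_bound_of_continuousOn hA
  obtain ⟨b, hb⟩ := isCompact_Icc.exists_bound_of_continuousOn hB
  have h01 : (0 : ℝ) ∈ Icc (0 : ℝ) 1 := by simp
  have hM0 : 0 ≤ M := (norm_nonneg _).trans (hM 0 h01)
  have hb0 : 0 ≤ b := (norm_nonneg _).trans (hb 0 h01)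
  -- `N` is the a priori Grönwall bound for any solution. Cutting the linear term off by `g`, which
  -- is `1` for `‖w‖ ≤ N` and `0` for `‖w‖ ≥ N + 1`, makes the right side bounded by `L`.
  -- Picard-Lindelöf on the ball of radius `L` then reaches time `1`.
  set N := b * gronwallBound 0 M 1 1 with hN
  have hN0 : 0 ≤ N := mul_nonneg hb0 (gronwallBound_zero_one_nonneg hM0)
  set g : X → ℝ := fun w => max 0 (min 1 (N + 1 - ‖w‖)) with hg
  have hg0 : ∀ w, 0 ≤ g w := fun w => le_max_left _ _
  have hg1 : ∀ w, g w ≤ 1 := fun w => max_le zero_le_one (min_le_left _ _)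
  have hgl : ∀ v w, |g v - g w| ≤ ‖v - w‖ := fun v w => by
    refine (abs_truncation_sub_le _ _).trans ?_
    rw [show N + 1 - ‖v‖ - (N + 1 - ‖w‖) = ‖w‖ - ‖v‖ by ring, norm_sub_rev v w]
    exact abs_norm_sub_norm_le w v
  have hgw : ∀ w, g w * ‖w‖ ≤ N + 1 := fun w => by
    by_cases h : ‖w‖ ≤ N + 1
    · exact (mul_le_of_le_one_left (norm_nonneg _) (hg1 w)).trans h
    · have : g w = 0 := max_eq_left ((min_le_right _ _).trans (by linarith))
      rw [this, zero_mul]; linarith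
  set L : NNReal := ⟨M * (N + 1) + b, by positivity⟩ with hL
  have hpl : IsPicardLindelof (fun t w => g w • A t w + B t) (tmin := 0) (tmax := 1) ⟨0, h01⟩
      (0 : X) L 0 L ⟨M + M * L, by positivity⟩ := by
    refine ⟨fun t ht => ?_, fun x _ => ?_, fun t ht x _ => ?_, by simp⟩
    · refine LipschitzOnWith.of_dist_le_mul fun x _ y hy => ?_
      rw [mem_closedBall_zero_iff] at hy
      rw [dist_eq_norm, dist_eq_norm]
      have : g x • A t x + B t - (g y • A t y + B t)
          = g x • A t (x - y) + (g x - g y) • A t y := by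
        rw [map_sub, smul_sub, sub_smul]; abel
      rw [this]
      have hAt := hM t ht
      calc _ ≤ ‖g x • A t (x - y)‖ + ‖(g x - g y) • A t y‖ := norm_add_le _ _
        _ ≤ 1 * (M * ‖x - y‖) + ‖x - y‖ * (M * L) := by
          rw [norm_smul, norm_smul, Real.norm_eq_abs, Real.norm_eq_abs, abs_of_nonneg (hg0 x)]
          gcongr
          · exact hg1 x
          · exact (A t).le_of_opNorm_le hAt _
          · exact hgl x y
          · exact ((A t).le_of_opNorm_le hAt _).trans (by gcongr)
        _ = (M + M * L) * ‖x - y‖ := by ring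
    · exact (continuousOn_const.smul (hA.clm_apply continuousOn_const)).add hB
    · calc ‖g x • A t x + B t‖ ≤ ‖g x • A t x‖ + ‖B t‖ := norm_add_le _ _
        _ ≤ g x * (M * ‖x‖) + b := by
          rw [norm_smul, Real.norm_eq_abs, abs_of_nonneg (hg0 x)]
          gcongr
          · exact (A t).le_of_opNorm_le (hM t ht) _
          · exact hb t ht
        _ = M * (g x * ‖x‖) + b := by ring
        _ ≤ M * (N + 1) + b := by gcongr; exact hgw x
  obtain ⟨w, hw0, hw⟩ := hpl.exists_eq_forall_mem_Icc_hasDerivWithinAt₀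
  refine ⟨w, hw0, fun t ht => ?_⟩
  -- The truncated solution obeys the same a priori bound `N`, so it never meets the cutoff and
  -- solves the linear equation itself.
  have hbd := norm_le_mul_gronwallBound hM0 hb0 hw hw0 (fun t ht => by
    calc ‖g (w t) • A t (w t) + B t‖ ≤ ‖g (w t) • A t (w t)‖ + ‖B t‖ := norm_add_le _ _
      _ ≤ 1 * (M * ‖w t‖) + b := by
          rw [norm_smul, Real.norm_eq_abs, abs_of_nonneg (hg0 _)]
          gcongr
          · exact hg1 _
          · exact (A t).le_of_opNorm_le (hM t ht) _
          · exact hb t ht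
      _ = M * ‖w t‖ + b := by ring) t ht
  have hgt : g (w t) = 1 := by
    have : min 1 (N + 1 - ‖w t‖) = 1 := min_eq_left (by linarith)
    simp [hg, this]
  have := hw t ht
  simpa only [hgt, one_smul] using this

/-- Uniform continuity along a compact graph inside an open set. -/
theorem exists_delta_along_graph {Z F : Type*} [PseudoMetricSpace Z] [PseudoMetricSpace F]
    {Ω : Set Z} (hΩ : IsOpen Ω) {D : ℝ × Z → F} (hD : ContinuousOn D (Icc (0 : ℝ) 1 ×ˢ Ω))
    {c : ℝ → Z} (hc : ContinuousOn c (Icc 0 1)) (hcΩ : ∀ t ∈ Icc (0 : ℝ) 1, c t ∈ Ω)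
    {ε : ℝ} (hε : 0 < ε) :
    ∃ δ > 0, ∀ t ∈ Icc (0 : ℝ) 1, ∀ x, dist x (c t) < δ →
      x ∈ Ω ∧ dist (D (t, x)) (D (t, c t)) < ε := by
  -- A sequence of counterexamples has times converging to some `a` along a subsequence. Its points
  -- then converge to `c a`, and continuity of `D` at `(a, c a)` is contradicted.
  by_contra! hcon
  choose! T hT x hx hbad using fun n : ℕ =>
    hcon (1 / ((n : ℝ) + 1)) Nat.one_div_pos_of_nat
  obtain ⟨a, ha, φ, hφ, hlim⟩ := isCompact_Icc.tendsto_subseq hT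
  have hTc : Tendsto (fun n => c (T (φ n))) atTop (𝓝 (c a)) :=
    (hc a ha).tendsto.comp (tendsto_nhdsWithin_iff.2 ⟨hlim, Eventually.of_forall fun n => hT _⟩)
  have hd : Tendsto (fun n => dist (x (φ n)) (c (T (φ n)))) atTop (𝓝 0) :=
    squeeze_zero (fun _ => dist_nonneg) (fun n => (hx (φ n)).le)
      (tendsto_one_div_add_atTop_nhds_zero_nat.comp hφ.tendsto_atTop)
  have hxc : Tendsto (fun n => x (φ n)) atTop (𝓝 (c a)) :=
    tendsto_iff_of_dist (by simpa only [dist_comm] using hd) |>.1 hTc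
  have hxΩ : ∀ᶠ n in atTop, x (φ n) ∈ Ω := hxc (hΩ.mem_nhds (hcΩ a ha))
  have hDa := hD (a, c a) ⟨ha, hcΩ a ha⟩
  have h1 : Tendsto (fun n => D (T (φ n), x (φ n))) atTop (𝓝 (D (a, c a))) :=
    hDa.tendsto.comp (tendsto_nhdsWithin_iff.2 ⟨hlim.prodMk_nhds hxc, by
      filter_upwards [hxΩ] with n hn using ⟨hT _, hn⟩⟩)
  have h2 : Tendsto (fun n => D (T (φ n), c (T (φ n)))) atTop (𝓝 (D (a, c a))) :=
    hDa.tendsto.comp (tendsto_nhdsWithin_iff.2 ⟨hlim.prodMk_nhds hTc,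
      Eventually.of_forall fun n => ⟨hT _, hcΩ _ (hT _)⟩⟩)
  have h3 := h1.dist h2
  rw [dist_self] at h3
  obtain ⟨n, hn, hn'⟩ := (hxΩ.and (h3.eventually (gt_mem_nhds hε))).exists
  exact absurd hn' (not_lt.2 (hbad _ hn))

end ParametricODE

/-! ### Differentiability of solutions in the parameter -/

section ParametricODE

open Filter Topology Function

variable {P G : Type*} [NormedAddCommGroup P] [NormedSpace ℝ P] [NormedAddCommGroup G]
  [NormedSpace ℝ G]

/-- A family `u t p` of solutions on `[0, 1]`, with parameter `p ∈ U` and zero initial value, of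
the differential equation `u' = f (t, p, u)`. -/
structure IsODEFamily (f : ℝ × (P × G) → G) (Ω : Set (P × G)) (U : Set P) (u : ℝ → P → G) :
    Prop where
  zero : ∀ p ∈ U, u 0 p = 0
  mem : ∀ t ∈ Icc (0 : ℝ) 1, ∀ p ∈ U, (p, u t p) ∈ Ω
  cont : ContinuousOn (fun q : ℝ × P => u q.1 q.2) (Icc (0 : ℝ) 1 ×ˢ U)
  deriv : ∀ t ∈ Icc (0 : ℝ) 1, ∀ p ∈ U,
    HasDerivWithinAt (fun s => u s p) (f (t, (p, u t p))) (Icc 0 1) t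

omit [NormedSpace ℝ P] in
theorem IsODEFamily.continuousOn_graph {f : ℝ × (P × G) → G} {Ω : Set (P × G)} {U : Set P}
    {u : ℝ → P → G} (h : IsODEFamily f Ω U u) :
    ContinuousOn (fun q : ℝ × P => (q.2, u q.1 q.2)) (Icc (0 : ℝ) 1 ×ˢ U) :=
  continuousOn_snd.prodMk h.cont

theorem ContinuousOn.comp_slice {T A B : Type*} [TopologicalSpace T] [TopologicalSpace A]
    [TopologicalSpace B] {g : T × A → B} {I : Set T} {U : Set A}
    (hg : ContinuousOn g (I ×ˢ U)) {a : A} (ha : a ∈ U) : ContinuousOn (fun t => g (t, a)) I :=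
  hg.comp (continuousOn_id.prodMk continuousOn_const) fun _ ht => ⟨ht, ha⟩

/-- The solution of a differential equation is differentiable in the parameter, and the derivative
solves the linearised equation and is continuous. -/
theorem IsODEFamily.exists_hasFDerivAt [CompleteSpace G] {f : ℝ × (P × G) → G} {Ω : Set (P × G)}
    {U : Set P} {u : ℝ → P → G} (h : IsODEFamily f Ω U u) (hΩ : IsOpen Ω) (hU : IsOpen U)
    {D : ℝ × (P × G) → (P × G →L[ℝ] G)} (hD : ContinuousOn D (Icc (0 : ℝ) 1 ×ˢ Ω))
    (hfD : ∀ t ∈ Icc (0 : ℝ) 1, ∀ x ∈ Ω, HasFDerivAt (fun x => f (t, x)) (D (t, x)) x) :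
    ∃ w : ℝ → P → (P →L[ℝ] G), (∀ p ∈ U, w 0 p = 0) ∧
      ContinuousOn (fun q : ℝ × P => w q.1 q.2) (Icc (0 : ℝ) 1 ×ˢ U) ∧
      (∀ t ∈ Icc (0 : ℝ) 1, ∀ p ∈ U, HasDerivWithinAt (fun s => w s p)
        ((D (t, (p, u t p))).comp ((ContinuousLinearMap.id ℝ P).prod (w t p))) (Icc 0 1) t) ∧
      ∀ t ∈ Icc (0 : ℝ) 1, ∀ p ∈ U, HasFDerivAt (u t) (w t p) p := by
  -- `A` and `B` are the partial derivatives of `f` in the state and in the parameter, along the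
  -- solution. The candidate derivative `W` solves `W' = A W + B`, `W 0 = 0`.
  set A : ℝ → P → (G →L[ℝ] G) := fun t p =>
    (D (t, (p, u t p))).comp (ContinuousLinearMap.inr ℝ P G) with hAdef
  set B : ℝ → P → (P →L[ℝ] G) := fun t p =>
    (D (t, (p, u t p))).comp (ContinuousLinearMap.inl ℝ P G) with hBdef
  have hDc : ContinuousOn (fun q : ℝ × P => D (q.1, (q.2, u q.1 q.2))) (Icc (0 : ℝ) 1 ×ˢ U) :=
    hD.comp (continuousOn_fst.prodMk h.continuousOn_graph)
      fun q hq => ⟨hq.1, h.mem _ hq.1 _ hq.2⟩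
  have hA : ContinuousOn (fun q : ℝ × P => A q.1 q.2) (Icc (0 : ℝ) 1 ×ˢ U) :=
    hDc.clm_comp continuousOn_const
  have hB : ContinuousOn (fun q : ℝ × P => B q.1 q.2) (Icc (0 : ℝ) 1 ×ˢ U) :=
    hDc.clm_comp continuousOn_const
  have hDAB : ∀ t p (v : P) (z : G), D (t, (p, u t p)) (v, z) = B t p v + A t p z := by
    intro t p v z
    simp only [hAdef, hBdef, ContinuousLinearMap.comp_apply, ContinuousLinearMap.inl_apply,
      ContinuousLinearMap.inr_apply, ← map_add, Prod.mk_add_mk, add_zero, zero_add]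
  have hex : ∀ p ∈ U, ∃ w : ℝ → (P →L[ℝ] G), w 0 = 0 ∧ ∀ t ∈ Icc (0 : ℝ) 1,
      HasDerivWithinAt w ((A t p).comp (w t) + B t p) (Icc 0 1) t := by
    intro p hp
    exact exists_linear_ode_solution (A := fun t => ContinuousLinearMap.compL ℝ P G G (A t p))
      ((ContinuousLinearMap.compL ℝ P G G).continuous.comp_continuousOn (hA.comp_slice hp))
      (hB.comp_slice hp)
  choose! W hW0 hW using hex
  have hbound : ∀ p ∈ U, ∃ M, 0 ≤ M ∧ ∀ t ∈ Icc (0 : ℝ) 1, ‖A t p‖ ≤ M ∧ ‖W p t‖ ≤ M := by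
    intro p hp
    obtain ⟨M₁, hM₁⟩ := isCompact_Icc.exists_bound_of_continuousOn (hA.comp_slice hp)
    obtain ⟨M₂, hM₂⟩ := isCompact_Icc.exists_bound_of_continuousOn
      (fun t ht => (hW p hp t ht).continuousWithinAt)
    refine ⟨max 0 (max M₁ M₂), le_max_left _ _, fun t ht => ⟨?_, ?_⟩⟩
    · exact (hM₁ t ht).trans ((le_max_left _ _).trans (le_max_right _ _))
    · exact (hM₂ t ht).trans ((le_max_right _ _).trans (le_max_right _ _))
  refine ⟨fun t p => W p t, hW0, ?_, ?_, ?_⟩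
  · rintro ⟨t₀, p₀⟩ ⟨ht₀, hp₀⟩
    obtain ⟨M, hM0, hM⟩ := hbound p₀ hp₀
    set C := gronwallBound 0 (M + 1) 1 1 with hC
    have hC0 : 0 ≤ C := gronwallBound_zero_one_nonneg (by positivity)
    -- uniform closeness in the parameter
    have key : ∀ ε > 0, ∀ᶠ p in 𝓝 p₀, ∀ t ∈ Icc (0 : ℝ) 1, ‖W p t - W p₀ t‖ ≤ ε := by
      intro ε hε
      -- The bound `η ≤ 1` absorbs the variation of `A` into the rate `M + 1`. The other bound makes
      -- the Grönwall output `η (M + 1) C` at most `ε`; `C + 1` avoids dividing by zero.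
      set η := min 1 (ε / ((M + 1) * (C + 1))) with hη
      have hη0 : 0 < η := lt_min one_pos (by positivity)
      obtain ⟨δ, hδ, hAδ⟩ := exists_delta_along_graph hU
        (hA.prodMk hB) (c := fun _ => p₀) continuousOn_const
        (fun _ _ => hp₀) hη0
      filter_upwards [Metric.ball_mem_nhds p₀ hδ] with p hp t ht
      have hpU := (hAδ 0 (by simp) p hp).1
      have hAp : ∀ t ∈ Icc (0 : ℝ) 1, ‖A t p - A t p₀‖ ≤ η ∧ ‖B t p - B t p₀‖ ≤ η := by
        intro t ht
        have := (hAδ t ht p hp).2.le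
        rw [Prod.dist_eq, max_le_iff, dist_eq_norm, dist_eq_norm] at this
        exact this
      have := norm_le_mul_gronwallBound (z := fun t => W p t - W p₀ t) (K := M + 1)
        (ε := η * (M + 1)) (by positivity) (by positivity)
        (fun t ht => (hW p hpU t ht).sub (hW p₀ hp₀ t ht)) (by simp [hW0, hpU, hp₀]) (by
          intro t ht
          have e : (A t p).comp (W p t) + B t p - ((A t p₀).comp (W p₀ t) + B t p₀)
              = (A t p₀).comp (W p t - W p₀ t) + (A t p - A t p₀).comp (W p t - W p₀ t)
                + ((A t p - A t p₀).comp (W p₀ t) + (B t p - B t p₀)) := by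
            ext v; simp; abel
          rw [e]
          obtain ⟨h1, h2⟩ := hAp t ht
          obtain ⟨h3, h4⟩ := hM t ht
          refine (norm_add_le _ _).trans (add_le_add ((norm_add_le _ _).trans ?_)
            ((norm_add_le _ _).trans ?_))
          · rw [add_mul, one_mul]
            refine add_le_add ((ContinuousLinearMap.opNorm_comp_le _ _).trans (by gcongr))
              ((ContinuousLinearMap.opNorm_comp_le _ _).trans ?_)
            exact mul_le_of_le_one_left (norm_nonneg _) (h1.trans (min_le_left _ _))
          · rw [mul_add, mul_one]
            exact add_le_add ((ContinuousLinearMap.opNorm_comp_le _ _).trans (by gcongr)) h2) t ht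
      refine this.trans ?_
      have h5 : η ≤ ε / ((M + 1) * (C + 1)) := min_le_right _ _
      calc η * (M + 1) * C ≤ ε / ((M + 1) * (C + 1)) * (M + 1) * (C + 1) := by
            gcongr; linarith
        _ = ε := by field_simp
    rw [Metric.continuousWithinAt_iff']
    intro ε hε
    have hcont := (hW p₀ hp₀ t₀ ht₀).continuousWithinAt
    have h1 : ∀ᶠ q : ℝ × P in 𝓝[Icc (0 : ℝ) 1 ×ˢ U] (t₀, p₀),
        dist (W p₀ q.1) (W p₀ t₀) < ε / 2 := by
      rw [nhdsWithin_prod_eq]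
      exact (tendsto_fst.eventually (Metric.continuousWithinAt_iff'.1 hcont (ε / 2) (half_pos hε)))
    have h2 : ∀ᶠ q : ℝ × P in 𝓝[Icc (0 : ℝ) 1 ×ˢ U] (t₀, p₀),
        ∀ t ∈ Icc (0 : ℝ) 1, ‖W q.2 t - W p₀ t‖ ≤ ε / 2 := by
      rw [nhdsWithin_prod_eq]
      exact tendsto_snd.eventually (nhdsWithin_le_nhds (key (ε / 2) (half_pos hε)))
    filter_upwards [h1, h2, self_mem_nhdsWithin] with q hq1 hq2 hq3
    calc dist (W q.2 q.1) (W p₀ t₀) ≤ dist (W q.2 q.1) (W p₀ q.1) + dist (W p₀ q.1) (W p₀ t₀) :=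
          dist_triangle _ _ _
      _ < ε := by
          have := hq2 q.1 hq3.1
          rw [← dist_eq_norm] at this
          linarith
  · intro t ht p hp
    refine (hW p hp t ht).congr_deriv ?_
    ext v
    simp [hDAB, add_comm]
  · intro t ht p hp
    obtain ⟨M, hM0, hM⟩ := hbound p hp
    set C := gronwallBound 0 (M + 1) 1 1 with hC
    have hC0 : 0 ≤ C := gronwallBound_zero_one_nonneg (by positivity)
    rw [hasFDerivAt_iff_isLittleO, Asymptotics.isLittleO_iff]
    intro ε hε
    set η := min 1 (ε / ((M + 1) * (C + 1))) with hη
    have hη0 : 0 < η := lt_min one_pos (by positivity)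
    obtain ⟨δ, hδ, hDδ⟩ := exists_delta_along_graph hΩ hD (c := fun t => (p, u t p))
      (continuousOn_const.prodMk (h.cont.comp_slice hp)) (fun t ht => h.mem t ht p hp) hη0
    -- continuity of `u` in the parameter, uniformly in time
    obtain ⟨δ', hδ', huδ⟩ := exists_delta_along_graph hU h.cont (c := fun _ => p)
      continuousOn_const (fun _ _ => hp) hδ
    filter_upwards [Metric.ball_mem_nhds p (lt_min hδ hδ')] with q hq
    rw [Metric.mem_ball, lt_min_iff] at hq
    have hqU : q ∈ U := (huδ 0 (by simp) q hq.2).1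
    -- First-order Taylor remainder of `f`, by the mean value inequality on a ball where `D` varies
    -- by less than `η`, with one radius for all times.
    have hmv : ∀ s ∈ Icc (0 : ℝ) 1, ‖f (s, (q, u s q)) - f (s, (p, u s p))
        - D (s, (p, u s p)) ((q, u s q) - (p, u s p))‖ ≤ η * (‖u s q - u s p‖ + ‖q - p‖) := by
      intro s hs
      have := Convex.norm_image_sub_le_of_norm_hasFDerivWithin_le' (𝕜 := ℝ)
        (f := fun x => f (s, x)) (f' := fun x => D (s, x)) (φ := D (s, (p, u s p))) (C := η)
        (s := Metric.ball (p, u s p) δ) (x := (p, u s p)) (y := (q, u s q))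
        (fun x hx => (hfD s hs x (hDδ s hs x hx).1).hasFDerivWithinAt)
        (fun x hx => by rw [← dist_eq_norm]; exact (hDδ s hs x hx).2.le)
        (convex_ball _ _) (Metric.mem_ball_self hδ)
        (by
          rw [Metric.mem_ball, Prod.dist_eq]
          exact max_lt hq.1 (huδ s hs q hq.2).2)
      refine this.trans ?_
      gcongr
      rw [Prod.mk_sub_mk, Prod.norm_mk]
      exact max_le (by linarith [norm_nonneg (u s q - u s p)]) (by linarith [norm_nonneg (q - p)])
    -- The error `z = u q - u p - W (q - p)` satisfies `z' = A z` plus the Taylor remainder. That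
    -- remainder is at most `η (‖z‖ + (M + 1) ‖q - p‖)`, so Grönwall gives `‖z‖ ≤ ε ‖q - p‖`.
    have := norm_le_mul_gronwallBound (z := fun s => u s q - u s p - W p s (q - p)) (K := M + 1)
      (ε := η * ((M + 1) * ‖q - p‖)) (by positivity) (by positivity)
      (fun s hs => ((h.deriv s hs q hqU).sub (h.deriv s hs p hp)).sub
        ((hW p hp s hs).clm_apply (hasDerivWithinAt_const s _ (q - p))))
      (by simp [h.zero, hqU, hp, hW0]) (by
        intro s hs
        have e : f (s, (q, u s q)) - f (s, (p, u s p))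
            - (((A s p).comp (W p s) + B s p) (q - p) + (W p s) 0)
            = (f (s, (q, u s q)) - f (s, (p, u s p))
              - D (s, (p, u s p)) ((q, u s q) - (p, u s p)))
              + A s p (u s q - u s p - W p s (q - p)) := by
          rw [Prod.mk_sub_mk, hDAB]
          simp only [_root_.add_apply, ContinuousLinearMap.comp_apply, map_zero,
            map_sub]
          abel
        rw [e]
        obtain ⟨h3, h4⟩ := hM s hs
        have h5 : ‖u s q - u s p‖ ≤ ‖u s q - u s p - W p s (q - p)‖ + M * ‖q - p‖ := by
          have h6 : ‖W p s (q - p)‖ ≤ M * ‖q - p‖ := (W p s).le_of_opNorm_le h4 _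
          have h7 := norm_add_le (u s q - u s p - W p s (q - p)) (W p s (q - p))
          rw [sub_add_cancel] at h7
          linarith
        have h8 : ‖A s p (u s q - u s p - W p s (q - p))‖
            ≤ M * ‖u s q - u s p - W p s (q - p)‖ := (A s p).le_of_opNorm_le h3 _
        have hη1 : η ≤ 1 := min_le_left _ _
        calc _ ≤ η * (‖u s q - u s p‖ + ‖q - p‖) + M * ‖u s q - u s p - W p s (q - p)‖ :=
              (norm_add_le _ _).trans (add_le_add (hmv s hs) h8)
          _ ≤ η * ((‖u s q - u s p - W p s (q - p)‖ + M * ‖q - p‖) + ‖q - p‖)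
              + M * ‖u s q - u s p - W p s (q - p)‖ := by gcongr
          _ = η * ‖u s q - u s p - W p s (q - p)‖ + M * ‖u s q - u s p - W p s (q - p)‖
              + η * ((M + 1) * ‖q - p‖) := by ring
          _ ≤ 1 * ‖u s q - u s p - W p s (q - p)‖ + M * ‖u s q - u s p - W p s (q - p)‖
              + η * ((M + 1) * ‖q - p‖) := by gcongr
          _ = _ := by ring) t ht
    refine this.trans ?_
    have h5 : η ≤ ε / ((M + 1) * (C + 1)) := min_le_right _ _
    calc η * ((M + 1) * ‖q - p‖) * C
        ≤ ε / ((M + 1) * (C + 1)) * ((M + 1) * ‖q - p‖) * (C + 1) := by gcongr; linarith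
      _ = ε * ‖q - p‖ := by field_simp

end ParametricODE

/-! ### Smooth dependence on time and parameters -/

section ParametricODE

open Filter Topology Function

universe u

variable {P G : Type u} [NormedAddCommGroup P] [NormedSpace ℝ P] [NormedAddCommGroup G]
  [NormedSpace ℝ G]

/-- The derivative of `f : ℝ × Z → G` in the second variable, on `[0, 1] × Ω`. -/
noncomputable def sliceFDeriv {Z G : Type*} [NormedAddCommGroup Z] [NormedSpace ℝ Z]
    [NormedAddCommGroup G] [NormedSpace ℝ G] (f : ℝ × Z → G) (Ω : Set Z) (q : ℝ × Z) : Z →L[ℝ] G :=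
  (fderivWithin ℝ f (Icc (0 : ℝ) 1 ×ˢ Ω) q).comp (ContinuousLinearMap.inr ℝ ℝ Z)

theorem uniqueDiffOn_Icc_prod {Z : Type*} [NormedAddCommGroup Z] [NormedSpace ℝ Z] {Ω : Set Z}
    (hΩ : IsOpen Ω) : UniqueDiffOn ℝ (Icc (0 : ℝ) 1 ×ˢ Ω) :=
  (uniqueDiffOn_Icc zero_lt_one).prod hΩ.uniqueDiffOn

theorem contDiffOn_sliceFDeriv {Z G : Type*} [NormedAddCommGroup Z] [NormedSpace ℝ Z]
    [NormedAddCommGroup G] [NormedSpace ℝ G] {f : ℝ × Z → G} {Ω : Set Z} (hΩ : IsOpen Ω)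
    (hf : ContDiffOn ℝ ∞ f (Icc (0 : ℝ) 1 ×ˢ Ω)) :
    ContDiffOn ℝ ∞ (sliceFDeriv f Ω) (Icc (0 : ℝ) 1 ×ˢ Ω) :=
  (hf.fderivWithin (uniqueDiffOn_Icc_prod hΩ) (by simp)).clm_comp contDiffOn_const

theorem hasFDerivAt_sliceFDeriv {Z G : Type*} [NormedAddCommGroup Z] [NormedSpace ℝ Z]
    [NormedAddCommGroup G] [NormedSpace ℝ G] {f : ℝ × Z → G} {Ω : Set Z} (hΩ : IsOpen Ω)
    (hf : ContDiffOn ℝ ∞ f (Icc (0 : ℝ) 1 ×ˢ Ω)) {t : ℝ} (ht : t ∈ Icc (0 : ℝ) 1) {x : Z}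
    (hx : x ∈ Ω) : HasFDerivAt (fun x => f (t, x)) (sliceFDeriv f Ω (t, x)) x := by
  have h1 := ((hf.differentiableOn (by simp)) (t, x) ⟨ht, hx⟩).hasFDerivWithinAt
  have h2 : HasFDerivWithinAt (fun x : Z => (t, x)) (ContinuousLinearMap.inr ℝ ℝ Z) Ω x :=
    (hasFDerivAt_prodMk_right t x).hasFDerivWithinAt
  exact (h1.comp x h2 fun y hy => ⟨ht, hy⟩).hasFDerivAt (hΩ.mem_nhds hx)

/-- Continuity of the partial derivatives implies total differentiability, on `[0, 1] × U`. -/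
theorem hasFDerivWithinAt_of_partial {P G : Type*} [NormedAddCommGroup P] [NormedSpace ℝ P]
    [NormedAddCommGroup G] [NormedSpace ℝ G] {u : ℝ → P → G} {U : Set P} (hU : IsOpen U)
    {I : Set ℝ} {w : ℝ → P → (P →L[ℝ] G)}
    (hw : ContinuousOn (fun q : ℝ × P => w q.1 q.2) (I ×ˢ U))
    (huw : ∀ t ∈ I, ∀ p ∈ U, HasFDerivAt (u t) (w t p) p) {t : ℝ} (ht : t ∈ I) {p : P}
    (hp : p ∈ U) {v : G} (hv : HasDerivWithinAt (fun s => u s p) v I t) :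
    HasFDerivWithinAt (fun q : ℝ × P => u q.1 q.2)
      (((1 : ℝ →L[ℝ] ℝ).smulRight v).coprod (w t p)) (I ×ˢ U) (t, p) := by
  -- The increment is split at `(q.1, p)`: the first part uses only the time derivative at `(t, p)`,
  -- the second the mean value inequality and the continuity of `w`.
  have h1 : (fun q : ℝ × P => u q.1 p - u t p - (q.1 - t) • v)
      =o[𝓝[I ×ˢ U] (t, p)] fun q => q - (t, p) := by
    have := hasDerivWithinAt_iff_isLittleO.1 hv
    have h2 : Tendsto (fun q : ℝ × P => q.1) (𝓝[I ×ˢ U] (t, p)) (𝓝[I] t) := by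
      rw [nhdsWithin_prod_eq]; exact tendsto_fst
    exact (this.comp_tendsto h2).trans_isBigO
      (Asymptotics.isBigO_of_le _ fun q => by simpa using norm_fst_le (q - (t, p)))
  have h2 : (fun q : ℝ × P => u q.1 q.2 - u q.1 p - w t p (q.2 - p))
      =o[𝓝[I ×ˢ U] (t, p)] fun q => q - (t, p) := by
    rw [Asymptotics.isLittleO_iff]
    intro ε hε
    have hc := Metric.continuousWithinAt_iff'.1 (hw (t, p) ⟨ht, hp⟩) ε hε
    obtain ⟨δ, hδ, hball⟩ := Metric.mem_nhdsWithin_iff.1 hc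
    obtain ⟨δ', hδ', hball'⟩ := Metric.mem_nhds_iff.1 (hU.mem_nhds hp)
    filter_upwards [self_mem_nhdsWithin, nhdsWithin_le_nhds
      (Metric.ball_mem_nhds (t, p) (lt_min hδ hδ'))] with q hq hqb
    rw [Metric.mem_ball, Prod.dist_eq, max_lt_iff, lt_min_iff, lt_min_iff] at hqb
    have := Convex.norm_image_sub_le_of_norm_hasFDerivWithin_le' (𝕜 := ℝ)
        (f := u q.1) (f' := w q.1) (φ := w t p) (C := ε)
        (s := Metric.ball p (min δ δ')) (x := p) (y := q.2)
        (fun x hx => (huw q.1 hq.1 x (hball' (Metric.ball_subset_ball (min_le_right _ _) hx)))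
          |>.hasFDerivWithinAt)
        (fun x hx => by
          rw [← dist_eq_norm]
          refine le_of_lt (hball (a := (q.1, x)) ⟨?_, hq.1,
            hball' (Metric.ball_subset_ball (min_le_right _ _) hx)⟩)
          rw [Metric.mem_ball, Prod.dist_eq]
          exact max_lt hqb.1.1 (Metric.ball_subset_ball (min_le_left _ _) hx))
        (convex_ball _ _) (Metric.mem_ball_self (lt_min hδ hδ')) (lt_min hqb.2.1 hqb.2.2)
    refine this.trans (mul_le_mul_of_nonneg_left ?_ hε.le)
    exact norm_snd_le (q - (t, p))
  rw [hasFDerivWithinAt_iff_isLittleO]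
  refine (h1.add h2).congr_left fun q => ?_
  simp
  abel

/-- Solutions of a smooth differential equation depend smoothly on time and on parameters. -/
theorem IsODEFamily.contDiffOn_nat (n : ℕ) : ∀ {G : Type u} [NormedAddCommGroup G]
    [NormedSpace ℝ G] [CompleteSpace G] {f : ℝ × (P × G) → G} {Ω : Set (P × G)} {U : Set P}
    {u : ℝ → P → G}, IsODEFamily f Ω U u → IsOpen Ω → IsOpen U →
    ContDiffOn ℝ ∞ f (Icc (0 : ℝ) 1 ×ˢ Ω) →
    ContDiffOn ℝ n (fun q : ℝ × P => u q.1 q.2) (Icc (0 : ℝ) 1 ×ˢ U) := by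
  -- The state space must vary in the induction, because the step passes from `G` to `G × (P →L[ℝ]
  -- G)`. This is also why `P` and `G` share a universe.
  induction n with
  | zero =>
    intro G _ _ _ f Ω U u h _ _ _
    exact contDiffOn_zero.2 h.cont
  | succ n ih =>
    intro G _ _ _ f Ω U u h hΩ hU hf
    have hD := contDiffOn_sliceFDeriv hΩ hf
    obtain ⟨w, hw0, hwc, hw, huw⟩ := h.exists_hasFDerivAt hΩ hU hD.continuousOn
      (fun t ht x hx => hasFDerivAt_sliceFDeriv hΩ hf ht hx)
    set pr : P × (G × (P →L[ℝ] G)) → P × G := fun x => (x.1, x.2.1) with hpr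
    have hprs : ContDiff ℝ ∞ pr := contDiff_fst.prodMk (contDiff_fst.comp contDiff_snd)
    -- The pair `(u, w)` of the solution and its parameter derivative solves an equation of the same
    -- kind, with smooth right side `f₁` and zero initial value. By induction both are `C^n`.
    set f₁ : ℝ × (P × (G × (P →L[ℝ] G))) → G × (P →L[ℝ] G) := fun q =>
      (f (q.1, pr q.2), (sliceFDeriv f Ω (q.1, pr q.2)).comp
        ((ContinuousLinearMap.id ℝ P).prod q.2.2.2)) with hf₁
    have hfam : IsODEFamily f₁ (pr ⁻¹' Ω) U (fun t p => (u t p, w t p)) := by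
      refine ⟨fun p hp => ?_, fun t ht p hp => h.mem t ht p hp, h.cont.prodMk hwc,
        fun t ht p hp => (h.deriv t ht p hp).prodMk (hw t ht p hp)⟩
      rw [h.zero p hp, hw0 p hp, Prod.mk_zero_zero]
    have hmaps : MapsTo (fun q : ℝ × (P × (G × (P →L[ℝ] G))) => (q.1, pr q.2))
        (Icc (0 : ℝ) 1 ×ˢ (pr ⁻¹' Ω)) (Icc (0 : ℝ) 1 ×ˢ Ω) := fun q hq => hq
    have hpr' : ContDiff ℝ ∞ (fun q : ℝ × (P × (G × (P →L[ℝ] G))) => (q.1, pr q.2)) :=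
      contDiff_fst.prodMk (hprs.comp contDiff_snd)
    have hf₁s : ContDiffOn ℝ ∞ f₁ (Icc (0 : ℝ) 1 ×ˢ (pr ⁻¹' Ω)) := by
      refine (hf.comp hpr'.contDiffOn hmaps).prodMk
        ((hD.comp hpr'.contDiffOn hmaps).clm_comp (ContDiff.contDiffOn ?_))
      have : (fun q : ℝ × (P × (G × (P →L[ℝ] G))) =>
          (ContinuousLinearMap.id ℝ P).prod q.2.2.2) = fun q =>
          ContinuousLinearMap.inl ℝ P G + (ContinuousLinearMap.inr ℝ P G).comp q.2.2.2 := by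
        funext q; ext v <;> simp
      rw [this]
      exact contDiff_const.add (contDiff_const.clm_comp
        (contDiff_snd.comp (contDiff_snd.comp contDiff_snd)))
    have hn := ih hfam (hΩ.preimage hprs.continuous) hU hf₁s
    have hun : ContDiffOn ℝ n (fun q : ℝ × P => u q.1 q.2) (Icc (0 : ℝ) 1 ×ˢ U) := hn.fst
    have hwn : ContDiffOn ℝ n (fun q : ℝ × P => w q.1 q.2) (Icc (0 : ℝ) 1 ×ˢ U) := hn.snd
    -- The total derivative of `u` is built from `∂_t u = f (t, p, u)` and `∂_p u = w`. Both are
    -- `C^n`, so `u` is `C^(n+1)`.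
    have hder : ∀ q ∈ Icc (0 : ℝ) 1 ×ˢ U, HasFDerivWithinAt (fun q : ℝ × P => u q.1 q.2)
        (((1 : ℝ →L[ℝ] ℝ).smulRight (f (q.1, (q.2, u q.1 q.2)))).coprod (w q.1 q.2))
        (Icc (0 : ℝ) 1 ×ˢ U) q := fun q hq =>
      hasFDerivWithinAt_of_partial hU hwc huw hq.1 hq.2 (h.deriv q.1 hq.1 q.2 hq.2)
    have hfn : ContDiffOn ℝ n (fun q : ℝ × P => f (q.1, (q.2, u q.1 q.2)))
        (Icc (0 : ℝ) 1 ×ˢ U) :=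
      (hf.of_le (by exact_mod_cast le_top)).comp
        (contDiffOn_fst.prodMk (contDiffOn_snd.prodMk hun))
        fun q hq => ⟨hq.1, h.mem _ hq.1 _ hq.2⟩
    push_cast
    rw [contDiffOn_succ_iff_fderivWithin (uniqueDiffOn_Icc_prod hU)]
    refine ⟨fun q hq => (hder q hq).differentiableWithinAt, by simp, ?_⟩
    refine ContDiffOn.congr ?_ fun q hq =>
      (hder q hq).fderivWithin (uniqueDiffOn_Icc_prod hU q hq)
    have : (fun q : ℝ × P =>
        (((1 : ℝ →L[ℝ] ℝ).smulRight (f (q.1, (q.2, u q.1 q.2)))).coprod (w q.1 q.2))) = fun q =>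
        (ContinuousLinearMap.smulRightL ℝ (ℝ × P) G (ContinuousLinearMap.fst ℝ ℝ P)
          (f (q.1, (q.2, u q.1 q.2)))) + (w q.1 q.2).comp (ContinuousLinearMap.snd ℝ ℝ P) := by
      funext q; ext v <;> simp
    rw [this]
    exact ((ContinuousLinearMap.contDiff _).comp_contDiffOn hfn).add
      (hwn.clm_comp contDiffOn_const)

theorem IsODEFamily.contDiffOn [CompleteSpace G] {f : ℝ × (P × G) → G} {Ω : Set (P × G)}
    {U : Set P} {u : ℝ → P → G} (h : IsODEFamily f Ω U u) (hΩ : IsOpen Ω) (hU : IsOpen U)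
    (hf : ContDiffOn ℝ ∞ f (Icc (0 : ℝ) 1 ×ˢ Ω)) :
    ContDiffOn ℝ ∞ (fun q : ℝ × P => u q.1 q.2) (Icc (0 : ℝ) 1 ×ˢ U) :=
  contDiffOn_infty.2 fun n => h.contDiffOn_nat n hΩ hU hf

end ParametricODE

/-! ### Smooth local flows in a normed space -/

section LocalFlow

open Filter Topology Function

/-- A smooth vector field on an open set has a smooth local flow. -/
theorem exists_smooth_local_flow {E : Type*} [NormedAddCommGroup E] [NormedSpace ℝ E]
    [CompleteSpace E] {X : E → E} {Ω : Set E} (hΩ : IsOpen Ω) (hX : ContDiffOn ℝ ∞ X Ω) {x₀ : E}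
    (hx₀ : x₀ ∈ Ω) :
    ∃ ε > 0, ∃ Ψ : ℝ × E → E,
      ContDiffOn ℝ ∞ Ψ (Ioo (-ε) ε ×ˢ Metric.ball x₀ ε) ∧
      ∀ x ∈ Metric.ball x₀ ε, Ψ (0, x) = x ∧ ∀ t ∈ Ioo (-ε) ε, Ψ (t, x) ∈ Ω ∧
        HasDerivAt (fun s => Ψ (s, x)) (X (Ψ (t, x))) t := by
  have hX1 : ContDiffAt ℝ 1 X x₀ := (hX.contDiffAt (hΩ.mem_nhds hx₀)).of_le (by simp)
  obtain ⟨ε, hε, a, r, L, K, hr, hpl⟩ := IsPicardLindelof.of_contDiffAt_one hX1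
  obtain ⟨α, hα, hαc⟩ :=
    (hpl 0).exists_forall_mem_closedBall_eq_hasDerivWithinAt_continuousOn
  simp only [zero_sub, zero_add] at hα hαc
  have hmem : Metric.closedBall x₀ r ×ˢ Icc (-ε) ε ∈ 𝓝 (x₀, (0 : ℝ)) :=
    prod_mem_nhds (Metric.closedBall_mem_nhds _ hr) (Icc_mem_nhds (by linarith) hε)
  have hα0 : α (x₀, 0) = x₀ := (hα x₀ (Metric.mem_closedBall_self hr.le)).1
  have hev : ∀ᶠ q in 𝓝 (x₀, (0 : ℝ)), α q ∈ Ω ∧ q ∈ Metric.closedBall x₀ r ×ˢ Icc (-ε) ε :=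
    ((hαc.continuousAt hmem).eventually (by rw [hα0]; exact hΩ.mem_nhds hx₀)).and hmem
  obtain ⟨δ, hδ, hball⟩ := Metric.eventually_nhds_iff_ball.1 hev
  have hball' : ∀ x ∈ Metric.ball x₀ δ, ∀ t ∈ Ioo (-δ) δ,
      α (x, t) ∈ Ω ∧ x ∈ Metric.closedBall x₀ r ∧ t ∈ Icc (-ε) ε := by
    intro x hx t ht
    refine hball (x, t) ?_
    rw [← ball_prod_same, mem_prod, Real.ball_eq_Ioo]
    simpa using ⟨hx, ht⟩
  have hderiv : ∀ x ∈ Metric.ball x₀ δ, ∀ t ∈ Ioo (-δ) δ,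
      HasDerivAt (fun s => α (x, s)) (X (α (x, t))) t := by
    intro x hx t ht
    have h1 := hball' x hx t ht
    refine ((hα x h1.2.1).2 t h1.2.2).hasDerivAt ?_
    exact mem_of_superset (isOpen_Ioo.mem_nhds ht) fun s hs => (hball' x hx s hs).2.2
  refine ⟨δ, hδ, fun q => α (q.2, q.1), ?_, fun x hx => ⟨(hα x (hball' x hx 0 (by simp [hδ])).2.1).1,
    fun t ht => ⟨(hball' x hx t ht).1, hderiv x hx t ht⟩⟩⟩
  have hst : ∀ s ∈ Icc (0 : ℝ) 1, ∀ t ∈ Ioo (-δ) δ, s * t ∈ Ioo (-δ) δ := by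
    intro s hs t ht
    rw [mem_Ioo, ← abs_lt] at ht ⊢
    rw [abs_mul, abs_of_nonneg hs.1]
    exact (mul_le_of_le_one_left (abs_nonneg t) hs.2).trans_lt ht
  set g : (ℝ × E) × E → E := fun y => y.1.2 + y.2 with hg
  have hgs : ContDiff ℝ ∞ g := (contDiff_snd.comp contDiff_fst).add contDiff_snd
  -- Time `t` and initial point `x` both become parameters: `s ↦ α (x, s t) - x` on `[0, 1]` starts
  -- at `0` and solves `u' = t X(x + u)`. Its value at `s = 1` recovers the flow.
  have hfam : IsODEFamily (fun q : ℝ × ((ℝ × E) × E) => q.2.1.1 • X (g q.2)) (g ⁻¹' Ω)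
      (Ioo (-δ) δ ×ˢ Metric.ball x₀ δ) (fun s p => α (p.2, s * p.1) - p.2) := by
    refine ⟨fun p hp => ?_, fun s hs p hp => ?_, ?_, fun s hs p hp => ?_⟩
    · simp [(hα p.2 (hball' p.2 hp.2 p.1 hp.1).2.1).1]
    · simpa [hg] using (hball' p.2 hp.2 _ (hst s hs p.1 hp.1)).1
    · refine (hαc.comp (by fun_prop) fun q hq => ?_).sub (by fun_prop)
      exact (hball' q.2.2 hq.2.2 _ (hst q.1 hq.1 q.2.1 hq.2.1)).2
    · have h1 := (hderiv p.2 hp.2 _ (hst s hs p.1 hp.1))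
      have h2 := (h1.scomp s (h := fun s => s * p.1) ((hasDerivAt_id s).mul_const p.1)).sub_const p.2
      simpa [hg] using h2.hasDerivWithinAt
  have hsm := hfam.contDiffOn (hΩ.preimage hgs.continuous) (isOpen_Ioo.prod Metric.isOpen_ball)
    ((contDiff_fst.comp (contDiff_fst.comp contDiff_snd)).contDiffOn.smul
      (hX.comp (hgs.comp contDiff_snd).contDiffOn fun q hq => hq.2))
  have hmap : MapsTo (fun p : ℝ × E => ((1 : ℝ), p)) (Ioo (-δ) δ ×ˢ Metric.ball x₀ δ)
      (Icc (0 : ℝ) 1 ×ˢ (Ioo (-δ) δ ×ˢ Metric.ball x₀ δ)) := fun p hp => ⟨by simp, hp⟩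
  have h1 : ContDiffOn ℝ ∞ (fun p : ℝ × E => α (p.2, 1 * p.1) - p.2)
      (Ioo (-δ) δ ×ˢ Metric.ball x₀ δ) :=
    hsm.comp (contDiff_const.prodMk contDiff_id).contDiffOn hmap
  refine (h1.add contDiff_snd.contDiffOn).congr fun p _ => ?_
  simp

end LocalFlow

/-! ### Vector fields, one-forms and exterior derivatives in a chart -/

section ChartCoordinates

open Filter Topology Function

variable {E : Type*} [NormedAddCommGroup E] [NormedSpace ℝ E]
  {Y : Type*} [TopologicalSpace Y] [ChartedSpace E Y] [IsManifold 𝓘(ℝ, E) ∞ Y]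

/-- The vector field which is constant, equal to `v`, in the chart at `z₀`. -/
noncomputable def chartConstField (z₀ : Y) (v : E) : VecField E Y :=
  fun y => mfderiv 𝓘(ℝ, E) 𝓘(ℝ, E) (extChartAt 𝓘(ℝ, E) z₀).symm (extChartAt 𝓘(ℝ, E) z₀ y) v

/-- A vector field read in the chart at `z₀`. -/
noncomputable def VecField.inChart (X : VecField E Y) (z₀ : Y) : E → E :=
  fun e => mfderiv 𝓘(ℝ, E) 𝓘(ℝ, E) (extChartAt 𝓘(ℝ, E) z₀) ((extChartAt 𝓘(ℝ, E) z₀).symm e)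
    (X ((extChartAt 𝓘(ℝ, E) z₀).symm e))

/-- A one-form read in the chart at `z₀`. -/
noncomputable def OneForm.inChart (lam : OneForm E Y) (z₀ : Y) : E → (E →L[ℝ] ℝ) :=
  fun e => (lam ((extChartAt 𝓘(ℝ, E) z₀).symm e)).comp
    (mfderiv 𝓘(ℝ, E) 𝓘(ℝ, E) (extChartAt 𝓘(ℝ, E) z₀).symm e)

theorem mfderiv_extChartAt_symm_comp (z₀ : Y) {y : Y} (hy : y ∈ (extChartAt 𝓘(ℝ, E) z₀).source)
    (v : TangentSpace 𝓘(ℝ, E) y) :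
    mfderiv 𝓘(ℝ, E) 𝓘(ℝ, E) (extChartAt 𝓘(ℝ, E) z₀).symm (extChartAt 𝓘(ℝ, E) z₀ y)
      (mfderiv 𝓘(ℝ, E) 𝓘(ℝ, E) (extChartAt 𝓘(ℝ, E) z₀) y v) = v := by
  have := mfderivWithin_extChartAt_symm_comp_mfderiv_extChartAt' hy
  rw [modelWithCornersSelf_coe, range_id, mfderivWithin_univ] at this
  exact congrArg (fun L => L v) this

theorem mfderiv_extChartAt_comp_symm (z₀ : Y) {y : Y} (hy : y ∈ (extChartAt 𝓘(ℝ, E) z₀).source)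
    (v : E) :
    mfderiv 𝓘(ℝ, E) 𝓘(ℝ, E) (extChartAt 𝓘(ℝ, E) z₀) y
      (mfderiv 𝓘(ℝ, E) 𝓘(ℝ, E) (extChartAt 𝓘(ℝ, E) z₀).symm (extChartAt 𝓘(ℝ, E) z₀ y) v) = v := by
  have := mfderiv_extChartAt_comp_mfderivWithin_extChartAt_symm' hy
  rw [modelWithCornersSelf_coe, range_id, mfderivWithin_univ] at this
  exact congrArg (fun L => L v) this

theorem trivializationAt_tangent_snd (z₀ : Y) {y : Y}
    (hy : y ∈ (extChartAt 𝓘(ℝ, E) z₀).source) (v : TangentSpace 𝓘(ℝ, E) y) :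
    (trivializationAt E (TangentSpace 𝓘(ℝ, E)) z₀ ⟨y, v⟩).2
      = mfderiv 𝓘(ℝ, E) 𝓘(ℝ, E) (extChartAt 𝓘(ℝ, E) z₀) y v := by
  rw [extChartAt_source] at hy
  rw [← TangentBundle.continuousLinearMapAt_trivializationAt hy]
  exact ((trivializationAt E (TangentSpace 𝓘(ℝ, E)) z₀).continuousLinearMapAt_apply_of_mem ℝ
    (by simpa using hy) v).symm

theorem VecField.smoothOn_source_iff (X : VecField E Y) (z₀ : Y) :
    X.SmoothOn (extChartAt 𝓘(ℝ, E) z₀).source ↔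
      ContMDiffOn 𝓘(ℝ, E) 𝓘(ℝ, E) ∞
        (fun y => (mfderiv 𝓘(ℝ, E) 𝓘(ℝ, E) (extChartAt 𝓘(ℝ, E) z₀) y (X y) : E))
        (extChartAt 𝓘(ℝ, E) z₀).source := by
  have h := (trivializationAt E (TangentSpace 𝓘(ℝ, E)) z₀).contMDiffOn_section_iff
    (IB := 𝓘(ℝ, E)) (n := ∞) (s := X) (a := (extChartAt 𝓘(ℝ, E) z₀).source)
    (isOpen_extChartAt_source z₀) (by simp)
  refine h.trans (contMDiffOn_congr fun y hy => ?_)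
  exact trivializationAt_tangent_snd z₀ hy (X y)

theorem chartConstField_smoothOn (z₀ : Y) (v : E) :
    (chartConstField z₀ v).SmoothOn (extChartAt 𝓘(ℝ, E) z₀).source := by
  rw [VecField.smoothOn_source_iff]
  exact (contMDiffOn_const (c := v)).congr fun y hy => mfderiv_extChartAt_comp_symm z₀ hy v

theorem VecField.contDiffOn_inChart {X : VecField E Y} (hX : X.SmoothOn univ) (z₀ : Y) :
    ContDiffOn ℝ ∞ (X.inChart z₀) (extChartAt 𝓘(ℝ, E) z₀).target := by
  rw [← contMDiffOn_iff_contDiffOn]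
  have h := (X.smoothOn_source_iff z₀).1 (hX.mono (subset_univ _))
  exact h.comp (contMDiffOn_extChartAt_symm z₀) (extChartAt 𝓘(ℝ, E) z₀).mapsTo_symm

omit [IsManifold 𝓘(ℝ, E) ∞ Y] in
theorem VecField.inChart_extChartAt (X : VecField E Y) (z₀ : Y) {y : Y}
    (hy : y ∈ (extChartAt 𝓘(ℝ, E) z₀).source) :
    X.inChart z₀ (extChartAt 𝓘(ℝ, E) z₀ y)
      = mfderiv 𝓘(ℝ, E) 𝓘(ℝ, E) (extChartAt 𝓘(ℝ, E) z₀) y (X y) := by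
  simp only [VecField.inChart]
  rw [(extChartAt 𝓘(ℝ, E) z₀).left_inv hy]

theorem mfderiv_extChartAt_symm_self (z₀ : Y) (v : E) :
    mfderiv 𝓘(ℝ, E) 𝓘(ℝ, E) (extChartAt 𝓘(ℝ, E) z₀).symm (extChartAt 𝓘(ℝ, E) z₀ z₀) v = v := by
  have := mfderivWithin_range_extChartAt_symm (I := 𝓘(ℝ, E)) (x := z₀)
  rw [modelWithCornersSelf_coe, range_id, mfderivWithin_univ] at this
  exact congrArg (fun L => L v) this

theorem contMDiffOn_pairing {b : ℝ → OneForm E Y} (hb : OneForm.SmoothPath b) {Z : VecField E Y}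
    {U : Set Y} (hZ : Z.SmoothOn U) :
    ContMDiffOn (𝓘(ℝ, ℝ).prod 𝓘(ℝ, E)) 𝓘(ℝ, ℝ) ∞ (fun p : ℝ × Y => b p.1 p.2 (Z p.2))
      (Icc (0 : ℝ) 1 ×ˢ U) := by
  have h := ContMDiffOn.clm_bundle_apply (F₁ := E) (F₂ := ℝ) (E₁ := TangentSpace 𝓘(ℝ, E))
    (E₂ := Bundle.Trivial Y ℝ) (b := fun p : ℝ × Y => p.2)
    (hb.mono (prod_mono_right (subset_univ U)))
    (hZ.comp contMDiffOn_snd (fun p hp => hp.2))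
  intro p hp
  exact ((Bundle.contMDiffWithinAt_totalSpace).1 (h p hp)).2

theorem OneForm.SmoothOn.smoothPath {lam : OneForm E Y} (h : lam.SmoothOn univ) :
    OneForm.SmoothPath (fun _ => lam) :=
  h.comp contMDiffOn_snd (fun _ _ => mem_univ _)

/-- In finite dimension a map into `E →L[ℝ] ℝ` is smooth as soon as its value on each fixed `v` is.
That value is the pairing of the form with the field constant in the chart. -/
theorem OneForm.SmoothPath.contDiffOn_inChart [FiniteDimensional ℝ E] {b : ℝ → OneForm E Y}
    (hb : OneForm.SmoothPath b) (z₀ : Y) :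
    ContDiffOn ℝ ∞ (fun q : ℝ × E => (b q.1).inChart z₀ q.2)
      (Icc (0 : ℝ) 1 ×ˢ (extChartAt 𝓘(ℝ, E) z₀).target) := by
  rw [contDiffOn_clm_apply]
  intro v
  have h := contMDiffOn_pairing hb (chartConstField_smoothOn z₀ v)
  have h2 : ContMDiffOn 𝓘(ℝ, ℝ × E) (𝓘(ℝ, ℝ).prod 𝓘(ℝ, E)) ∞
      (fun q : ℝ × E => (q.1, (extChartAt 𝓘(ℝ, E) z₀).symm q.2))
      (Icc (0 : ℝ) 1 ×ˢ (extChartAt 𝓘(ℝ, E) z₀).target) :=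
    (contDiff_fst.contMDiff.contMDiffOn).prodMk
      ((contMDiffOn_extChartAt_symm z₀).comp contDiff_snd.contMDiff.contMDiffOn fun q hq => hq.2)
  rw [← contMDiffOn_iff_contDiffOn]
  refine (h.comp h2 fun q hq => ⟨hq.1, (extChartAt 𝓘(ℝ, E) z₀).map_target hq.2⟩).congr ?_
  intro q hq
  simp only [OneForm.inChart, chartConstField, comp_apply]
  rw [(extChartAt 𝓘(ℝ, E) z₀).right_inv hq.2]
  rfl

omit [IsManifold 𝓘(ℝ, E) ∞ Y] in
theorem dirDeriv_eq_fderiv {f : Y → ℝ} {z₀ : Y} (hf : MDifferentiableAt 𝓘(ℝ, E) 𝓘(ℝ, ℝ) f z₀)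
    (w : TangentSpace 𝓘(ℝ, E) z₀) :
    dirDeriv f z₀ w
      = fderiv ℝ (fun e => f ((extChartAt 𝓘(ℝ, E) z₀).symm e)) (extChartAt 𝓘(ℝ, E) z₀ z₀) w := by
  rw [dirDeriv, hf.mfderiv, modelWithCornersSelf_coe, range_id, fderivWithin_univ]
  rfl

theorem mpullbackWithin_eq_inChart (X : VecField E Y) (z₀ : Y) {e : E}
    (he : e ∈ (extChartAt 𝓘(ℝ, E) z₀).target) :
    VectorField.mpullbackWithin 𝓘(ℝ, E) 𝓘(ℝ, E) (extChartAt 𝓘(ℝ, E) z₀).symm X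
      (range 𝓘(ℝ, E)) e = X.inChart z₀ e := by
  have h1 := mfderivWithin_extChartAt_symm_comp_mfderiv_extChartAt (I := 𝓘(ℝ, E)) he
  have h2 := mfderiv_extChartAt_comp_mfderivWithin_extChartAt_symm (I := 𝓘(ℝ, E)) he
  rw [VectorField.mpullbackWithin_apply, ContinuousLinearMap.inverse_eq h1 h2]
  rfl

theorem lieBracketWithin_const {V V' W : E → E} {e v : E} {s : Set E} (hV : V =ᶠ[𝓝 e] V')
    (hW : W =ᶠ[𝓝 e] fun _ => v) (hs : s = univ) :
    VectorField.lieBracketWithin ℝ V W s e = - fderiv ℝ V' e v := by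
  rw [hs, VectorField.lieBracketWithin_univ, VectorField.lieBracket_eq]
  dsimp only
  rw [hV.fderiv_eq, hW.fderiv_eq, hW.eq_of_nhds]
  simp

/-- In the chart the second field is constant, so only the term `-DX(v)` of the bracket remains. At
the centre of the chart the differential of the chart is the identity, so the value needs no
transport. -/
theorem mlieBracket_chartConstField (X : VecField E Y) (z₀ : Y) (v : E) :
    VectorField.mlieBracket 𝓘(ℝ, E) X (chartConstField z₀ v) z₀
      = - fderiv ℝ (X.inChart z₀) (extChartAt 𝓘(ℝ, E) z₀ z₀) v := by
  have ht : (extChartAt 𝓘(ℝ, E) z₀).target ∈ 𝓝 (extChartAt 𝓘(ℝ, E) z₀ z₀) :=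
    extChartAt_target_mem_nhds z₀
  have hid : (mfderiv 𝓘(ℝ, E) 𝓘(ℝ, E) (extChartAt 𝓘(ℝ, E) z₀) z₀ : E →L[ℝ] E).inverse
      = ContinuousLinearMap.id ℝ E := by
    have : (mfderiv 𝓘(ℝ, E) 𝓘(ℝ, E) (extChartAt 𝓘(ℝ, E) z₀) z₀ : E →L[ℝ] E)
        = ContinuousLinearMap.id ℝ E := mfderiv_extChartAt_self
    exact (congrArg ContinuousLinearMap.inverse this).trans ContinuousLinearMap.inverse_id
  rw [← VectorField.mlieBracketWithin_univ, VectorField.mlieBracketWithin_apply]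
  refine (congrArg (fun L : E →L[ℝ] E => L _) hid).trans ?_
  have h1 : VectorField.mpullbackWithin 𝓘(ℝ, E) 𝓘(ℝ, E) (extChartAt 𝓘(ℝ, E) z₀).symm X
      (range 𝓘(ℝ, E))
      =ᶠ[𝓝 (extChartAt 𝓘(ℝ, E) z₀ z₀)] X.inChart z₀ := by
    filter_upwards [ht] with e he
    exact mpullbackWithin_eq_inChart X z₀ he
  have h2 : VectorField.mpullbackWithin 𝓘(ℝ, E) 𝓘(ℝ, E) (extChartAt 𝓘(ℝ, E) z₀).symm
      (chartConstField z₀ v) (range 𝓘(ℝ, E)) =ᶠ[𝓝 (extChartAt 𝓘(ℝ, E) z₀ z₀)] fun _ => v := by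
    filter_upwards [ht] with e he
    refine (mpullbackWithin_eq_inChart (chartConstField z₀ v) z₀ he).trans ?_
    exact mfderiv_extChartAt_comp_symm z₀ ((extChartAt 𝓘(ℝ, E) z₀).map_target he) v
  exact lieBracketWithin_const h1 h2 (by simp)

/-- The exterior derivative of a one-form in the chart at `z₀`, when `λ(X)` is constant. -/
theorem OneForm.dApply_chartConstField [FiniteDimensional ℝ E] {lam : OneForm E Y}
    (hlam : lam.SmoothOn univ)
    {X : VecField E Y} (hX : ∀ y, lam y (X y) = 1) (z₀ : Y) (v : E) :
    lam.dApply X (chartConstField z₀ v) z₀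
      = fderiv ℝ (lam.inChart z₀) (extChartAt 𝓘(ℝ, E) z₀ z₀) (X z₀) v
        + lam z₀ (fderiv ℝ (X.inChart z₀) (extChartAt 𝓘(ℝ, E) z₀ z₀) v) := by
  have ht : (extChartAt 𝓘(ℝ, E) z₀).target ∈ 𝓝 (extChartAt 𝓘(ℝ, E) z₀ z₀) :=
    extChartAt_target_mem_nhds z₀
  have hs : ContDiffOn ℝ ∞ (lam.inChart z₀) (extChartAt 𝓘(ℝ, E) z₀).target :=
    (hlam.smoothPath.contDiffOn_inChart z₀).comp
      (contDiff_prodMk_right (0 : ℝ)).contDiffOn fun e he => ⟨by simp, he⟩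
  have hd : DifferentiableAt ℝ (lam.inChart z₀) (extChartAt 𝓘(ℝ, E) z₀ z₀) :=
    (hs.contDiffAt ht).differentiableAt (by simp)
  have hmd : MDifferentiableAt 𝓘(ℝ, E) 𝓘(ℝ, ℝ) (fun z => lam z (chartConstField z₀ v z)) z₀ := by
    have h1 := contMDiffOn_pairing hlam.smoothPath (chartConstField_smoothOn z₀ v)
    have h2 : ContMDiffOn 𝓘(ℝ, E) 𝓘(ℝ, ℝ) ∞ (fun z => lam z (chartConstField z₀ v z))
        (extChartAt 𝓘(ℝ, E) z₀).source :=
      h1.comp (contMDiffOn_const.prodMk contMDiffOn_id : ContMDiffOn _ _ _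
        (fun z : Y => ((0 : ℝ), z)) _) fun z hz => ⟨by simp, hz⟩
    exact ((h2.contMDiffAt (extChartAt_source_mem_nhds z₀)).mdifferentiableAt (by simp))
  have h3 : (fun e => lam ((extChartAt 𝓘(ℝ, E) z₀).symm e)
      (chartConstField z₀ v ((extChartAt 𝓘(ℝ, E) z₀).symm e)))
      =ᶠ[𝓝 (extChartAt 𝓘(ℝ, E) z₀ z₀)] fun e => lam.inChart z₀ e v := by
    filter_upwards [ht] with e he
    simp only [OneForm.inChart, chartConstField]
    rw [(extChartAt 𝓘(ℝ, E) z₀).right_inv he]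
    rfl
  -- The three terms of Cartan's formula; the second vanishes because `λ(X)` is constant. The sum is
  -- the coordinate expression of the Lie derivative of `λ` along `X`, which equals `i_X dλ` here.
  have e1 : dirDeriv (fun z => lam z (chartConstField z₀ v z)) z₀ (X z₀)
      = fderiv ℝ (lam.inChart z₀) (extChartAt 𝓘(ℝ, E) z₀ z₀) (X z₀) v := by
    rw [dirDeriv_eq_fderiv hmd, h3.fderiv_eq, fderiv_clm_apply hd (differentiableAt_const v)]
    simp
    rfl
  have e2 : dirDeriv (fun z => lam z (X z)) z₀ (chartConstField z₀ v z₀) = 0 := by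
    rw [funext hX, dirDeriv_eq_fderiv mdifferentiableAt_const]
    simp
    rfl
  have e3 : lam z₀ (VectorField.mlieBracket 𝓘(ℝ, E) X (chartConstField z₀ v) z₀)
      = - lam z₀ (fderiv ℝ (X.inChart z₀) (extChartAt 𝓘(ℝ, E) z₀ z₀) v) := by
    rw [mlieBracket_chartConstField]
    exact map_neg (lam z₀ : E →L[ℝ] ℝ) _
  rw [OneForm.dApply, e1, e2, e3]
  ring

end ChartCoordinates

/-! ### Global flow of a vector field on a compact manifold -/

section Flow

open Filter Topology Function

variable {E : Type*} [NormedAddCommGroup E] [NormedSpace ℝ E]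
  {Y : Type*} [TopologicalSpace Y] [ChartedSpace E Y] [IsManifold 𝓘(ℝ, E) ∞ Y]

/-- A smooth vector field on a manifold has a smooth local flow. -/
theorem VecField.exists_local_flow [CompleteSpace E] {X : VecField E Y} (hX : X.SmoothOn univ)
    (y₀ : Y) :
    ∃ ε > 0, ∃ W : Set Y, IsOpen W ∧ y₀ ∈ W ∧ ∃ ψ : ℝ × Y → Y,
      ContMDiffOn (𝓘(ℝ, ℝ).prod 𝓘(ℝ, E)) 𝓘(ℝ, E) ∞ ψ (Ioo (-ε) ε ×ˢ W) ∧
      ∀ y ∈ W, ψ (0, y) = y ∧ IsMIntegralCurveOn (fun t => ψ (t, y)) X (Ioo (-ε) ε) := by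
  obtain ⟨ε, hε, Ψ, hΨ, hΨ'⟩ := exists_smooth_local_flow (isOpen_extChartAt_target (I := 𝓘(ℝ, E)) y₀)
    (VecField.contDiffOn_inChart hX y₀) (mem_extChartAt_target y₀)
  set c := extChartAt 𝓘(ℝ, E) y₀ with hc
  have hcs : ContMDiffOn 𝓘(ℝ, E) 𝓘(ℝ, E) ∞ c.symm c.target := contMDiffOn_extChartAt_symm y₀
  have hcc : ContMDiffOn 𝓘(ℝ, E) 𝓘(ℝ, E) ∞ c c.source := by
    rw [hc, extChartAt_source]; exact contMDiffOn_extChartAt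
  refine ⟨ε, hε, c.source ∩ c ⁻¹' Metric.ball (c y₀) ε,
    (continuousOn_extChartAt y₀).isOpen_inter_preimage (isOpen_extChartAt_source y₀)
      Metric.isOpen_ball, ⟨mem_extChartAt_source y₀, Metric.mem_ball_self hε⟩,
    fun q => c.symm (Ψ (q.1, c q.2)), ?_, fun y hy => ⟨?_, fun t ht => ?_⟩⟩
  · have h1 : ContMDiffOn (𝓘(ℝ, ℝ).prod 𝓘(ℝ, E)) 𝓘(ℝ, ℝ × E) ∞
        (fun q : ℝ × Y => (q.1, c q.2)) (Ioo (-ε) ε ×ˢ (c.source ∩ c ⁻¹' Metric.ball (c y₀) ε)) :=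
      contMDiffOn_fst.prodMk_space (hcc.comp contMDiffOn_snd fun q hq => hq.2.1)
    exact hcs.comp ((contMDiffOn_iff_contDiffOn.2 hΨ).comp h1 fun q hq => ⟨hq.1, hq.2.2⟩)
      fun q hq => ((hΨ' _ hq.2.2).2 _ hq.1).1
  · simp only [(hΨ' _ hy.2).1, c.left_inv hy.1]
  · obtain ⟨h1, h2⟩ := (hΨ' _ hy.2).2 t ht
    have h3 : HasMFDerivAt 𝓘(ℝ, E) 𝓘(ℝ, E) c.symm (Ψ (t, c y))
        (mfderiv 𝓘(ℝ, E) 𝓘(ℝ, E) c.symm (Ψ (t, c y))) :=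
      ((hcs.contMDiffAt ((isOpen_extChartAt_target y₀).mem_nhds h1)).mdifferentiableAt
        (by simp)).hasMFDerivAt
    have h4 := (h3.comp t h2.hasFDerivAt.hasMFDerivAt).hasMFDerivWithinAt (s := Ioo (-ε) ε)
    refine h4.congr_mfderiv ?_
    ext
    have h5 := mfderiv_extChartAt_symm_comp y₀ (c.map_target h1) (X (c.symm (Ψ (t, c y))))
    rw [c.right_inv h1] at h5
    exact (congrArg (fun v : E => (mfderiv 𝓘(ℝ, E) 𝓘(ℝ, E) c.symm (Ψ (t, c y)) : E →L[ℝ] E) v)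
      (one_smul ℝ _)).trans (h5.trans (one_smul ℝ _).symm)

/-- Compactness: having a common `ε` for all points of a set passes to subsets and to unions of two
sets, and holds near every point. -/
theorem VecField.exists_uniform_local_flow [CompleteSpace E] [CompactSpace Y] {X : VecField E Y}
    (hX : X.SmoothOn univ) :
    ∃ ε > 0, ∀ y₀ : Y, ∃ W : Set Y, IsOpen W ∧ y₀ ∈ W ∧ ∃ ψ : ℝ × Y → Y,
      ContMDiffOn (𝓘(ℝ, ℝ).prod 𝓘(ℝ, E)) 𝓘(ℝ, E) ∞ ψ (Ioo (-ε) ε ×ˢ W) ∧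
      ∀ y ∈ W, ψ (0, y) = y ∧ IsMIntegralCurveOn (fun t => ψ (t, y)) X (Ioo (-ε) ε) := by
  have key : ∃ ε > 0, ∀ y₀ ∈ (univ : Set Y), ∃ W : Set Y, IsOpen W ∧ y₀ ∈ W ∧ ∃ ψ : ℝ × Y → Y,
      ContMDiffOn (𝓘(ℝ, ℝ).prod 𝓘(ℝ, E)) 𝓘(ℝ, E) ∞ ψ (Ioo (-ε) ε ×ˢ W) ∧
      ∀ y ∈ W, ψ (0, y) = y ∧ IsMIntegralCurveOn (fun t => ψ (t, y)) X (Ioo (-ε) ε) := by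
    have hmono : ∀ ε ε' : ℝ, ε' ≤ ε → Ioo (-ε') ε' ⊆ Ioo (-ε) ε := fun ε ε' h =>
      Ioo_subset_Ioo (neg_le_neg h) h
    refine isCompact_univ.induction_on (p := fun S => ∃ ε > 0, ∀ y₀ ∈ S, ∃ W : Set Y,
      IsOpen W ∧ y₀ ∈ W ∧ ∃ ψ : ℝ × Y → Y,
      ContMDiffOn (𝓘(ℝ, ℝ).prod 𝓘(ℝ, E)) 𝓘(ℝ, E) ∞ ψ (Ioo (-ε) ε ×ˢ W) ∧
      ∀ y ∈ W, ψ (0, y) = y ∧ IsMIntegralCurveOn (fun t => ψ (t, y)) X (Ioo (-ε) ε)) ?_ ?_ ?_ ?_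
    · exact ⟨1, one_pos, by simp⟩
    · rintro S T hST ⟨ε, hε, h⟩
      exact ⟨ε, hε, fun y hy => h y (hST hy)⟩
    · rintro S T ⟨ε, hε, h⟩ ⟨ε', hε', h'⟩
      refine ⟨min ε ε', lt_min hε hε', ?_⟩
      rintro y (hy | hy)
      · obtain ⟨W, hW, hyW, ψ, hψ, hψ'⟩ := h y hy
        exact ⟨W, hW, hyW, ψ, hψ.mono (prod_mono_left (hmono _ _ (min_le_left _ _))),
          fun z hz => ⟨(hψ' z hz).1, (hψ' z hz).2.mono (hmono _ _ (min_le_left _ _))⟩⟩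
      · obtain ⟨W, hW, hyW, ψ, hψ, hψ'⟩ := h' y hy
        exact ⟨W, hW, hyW, ψ, hψ.mono (prod_mono_left (hmono _ _ (min_le_right _ _))),
          fun z hz => ⟨(hψ' z hz).1, (hψ' z hz).2.mono (hmono _ _ (min_le_right _ _))⟩⟩
    · intro y _
      obtain ⟨ε, hε, W, hW, hyW, h⟩ := VecField.exists_local_flow hX y
      exact ⟨W, mem_nhdsWithin_of_mem_nhds (hW.mem_nhds hyW), ε, hε, fun z hz => ⟨W, hW, hz, h⟩⟩
  obtain ⟨ε, hε, h⟩ := key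
  exact ⟨ε, hε, fun y => h y (mem_univ y)⟩

/-- The global flow of a vector field. -/
structure IsSmoothFlow (X : VecField E Y) (Φ : ℝ → Y → Y) : Prop where
  zero : ∀ y, Φ 0 y = y
  add : ∀ s t y, Φ s (Φ t y) = Φ (s + t) y
  smooth : ContMDiff (𝓘(ℝ, ℝ).prod 𝓘(ℝ, E)) 𝓘(ℝ, E) ∞ (fun p : ℝ × Y => Φ p.1 p.2)
  curve : ∀ y, IsMIntegralCurve (fun t => Φ t y) X

/-- A smooth vector field on a compact manifold has a smooth global flow. -/
theorem VecField.exists_isSmoothFlow [CompleteSpace E] [T2Space Y] [CompactSpace Y]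
    {X : VecField E Y} (hX : X.SmoothOn univ) : ∃ Φ : ℝ → Y → Y, IsSmoothFlow X Φ := by
  have hX1 : ContMDiff 𝓘(ℝ, E) 𝓘(ℝ, E).tangent 1
      (fun y => (⟨y, X y⟩ : TangentBundle 𝓘(ℝ, E) Y)) :=
    (contMDiffOn_univ.1 hX).of_le (by simp)
  obtain ⟨ε, hε, hloc⟩ := VecField.exists_uniform_local_flow hX
  have hex : ∀ y : Y, ∃ γ : ℝ → Y, γ 0 = y ∧ IsMIntegralCurve γ X :=
    exists_isMIntegralCurve_of_isMIntegralCurveOn hX1 hε fun y => by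
      obtain ⟨W, _, hyW, ψ, _, hψ⟩ := hloc y
      exact ⟨fun t => ψ (t, y), hψ y hyW⟩
  choose γ hγ0 hγ using hex
  have hadd : ∀ s t y, γ (γ y t) s = γ y (s + t) := by
    intro s t y
    refine congrFun (isMIntegralCurve_Ioo_eq_of_contMDiff_boundaryless (t₀ := 0) hX1 (hγ _)
      ((hγ y).comp_add t) ?_) s
    simp [hγ0]
  refine ⟨fun t y => γ y t, ⟨hγ0, hadd, ?_, hγ⟩⟩
  have hsmall : ContMDiffOn (𝓘(ℝ, ℝ).prod 𝓘(ℝ, E)) 𝓘(ℝ, E) ∞ (fun p : ℝ × Y => γ p.2 p.1)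
      (Ioo (-ε) ε ×ˢ univ) := by
    rintro ⟨t, y⟩ ⟨ht, -⟩
    obtain ⟨W, hW, hyW, ψ, hψs, hψ⟩ := hloc y
    have hopen : Ioo (-ε) ε ×ˢ W ∈ 𝓝 (t, y) := prod_mem_nhds (isOpen_Ioo.mem_nhds ht) (hW.mem_nhds hyW)
    refine ((hψs.contMDiffAt hopen).congr_of_eventuallyEq ?_).contMDiffWithinAt
    filter_upwards [hopen] with q hq
    exact isMIntegralCurveOn_Ioo_eqOn_of_contMDiff_boundaryless (t₀ := 0) (by simpa using hε)
      hX1 ((hγ q.2).isMIntegralCurveOn _) (hψ q.2 hq.2).2 ((hγ0 _).trans (hψ q.2 hq.2).1.symm) hq.1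
  -- The map at time `n t` is the `n`-fold iterate of the map at time `t`, which is smooth for `|t|
  -- < ε`. Every time is `n t` for such a `t`.
  have hmul : ∀ n : ℕ, ContMDiffOn (𝓘(ℝ, ℝ).prod 𝓘(ℝ, E)) 𝓘(ℝ, E) ∞
      (fun p : ℝ × Y => γ p.2 (n * p.1)) (Ioo (-ε) ε ×ˢ univ) := by
    intro n
    induction n with
    | zero => simpa [hγ0] using contMDiffOn_snd
    | succ n ih =>
      have : ContMDiffOn (𝓘(ℝ, ℝ).prod 𝓘(ℝ, E)) 𝓘(ℝ, E) ∞
          (fun p : ℝ × Y => γ (γ p.2 (n * p.1)) p.1) (Ioo (-ε) ε ×ˢ univ) :=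
        hsmall.comp (contMDiffOn_fst.prodMk ih) fun p hp => ⟨hp.1, mem_univ _⟩
      refine this.congr fun p _ => ?_
      rw [hadd]; push_cast; ring_nf
  rintro ⟨t, y⟩
  obtain ⟨n, hn⟩ := exists_nat_gt (|t| / ε)
  have hn0 : (0 : ℝ) < n := (div_nonneg (abs_nonneg t) hε.le).trans_lt hn
  have ht : t / n ∈ Ioo (-ε) ε := by
    rw [mem_Ioo, ← abs_lt, abs_div, abs_of_pos hn0, div_lt_iff₀ hn0]
    rwa [div_lt_iff₀ hε, mul_comm] at hn
  have h1 : ContMDiffAt (𝓘(ℝ, ℝ).prod 𝓘(ℝ, E)) (𝓘(ℝ, ℝ).prod 𝓘(ℝ, E)) ∞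
      (fun p : ℝ × Y => (p.1 / n, p.2)) (t, y) :=
    ((contDiff_id.div_const (n : ℝ)).contMDiff.comp contMDiff_fst).prodMk contMDiff_snd _
  have h2 := ((hmul n).contMDiffAt (x := (t / n, y))
    (prod_mem_nhds (isOpen_Ioo.mem_nhds ht) univ_mem)).comp (t, y) h1
  refine h2.congr_of_eventuallyEq (Eventually.of_forall fun p => ?_)
  simp only [comp_apply]
  rw [mul_div_cancel₀ _ hn0.ne']

end Flow

/-! ### Scalar equations with a parameter on the manifold -/

section ScalarODE

open Filter Topology Function

universe u

variable {E : Type u} [NormedAddCommGroup E] [NormedSpace ℝ E]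
  {Y : Type*} [TopologicalSpace Y] [ChartedSpace E Y] [IsManifold 𝓘(ℝ, E) ∞ Y]

/-- `τ` solves `τ' = h (t, τ, y)` on `[0, 1]`, with `τ 0 = 0`. -/
def IsScalarSolution (h : ℝ → ℝ → Y → ℝ) (y : Y) (τ : ℝ → ℝ) : Prop :=
  τ 0 = 0 ∧ ∀ t ∈ Icc (0 : ℝ) 1, HasDerivWithinAt τ (h t (τ t) y) (Icc 0 1) t

variable {h : ℝ → ℝ → Y → ℝ}

theorem contDiffOn_scalar_inChart
    (hh : ContMDiffOn (𝓘(ℝ, ℝ).prod (𝓘(ℝ, ℝ).prod 𝓘(ℝ, E))) 𝓘(ℝ, ℝ) ∞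
      (fun q : ℝ × (ℝ × Y) => h q.1 q.2.1 q.2.2) (Icc (0 : ℝ) 1 ×ˢ univ)) (y₀ : Y) :
    ContDiffOn ℝ ∞ (fun q : ℝ × (E × ℝ) => h q.1 q.2.2 ((extChartAt 𝓘(ℝ, E) y₀).symm q.2.1))
      (Icc (0 : ℝ) 1 ×ˢ ((extChartAt 𝓘(ℝ, E) y₀).target ×ˢ univ)) := by
  rw [← contMDiffOn_iff_contDiffOn]
  have h1 : ContMDiffOn 𝓘(ℝ, ℝ × (E × ℝ)) (𝓘(ℝ, ℝ).prod (𝓘(ℝ, ℝ).prod 𝓘(ℝ, E))) ∞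
      (fun q : ℝ × (E × ℝ) => (q.1, (q.2.2, (extChartAt 𝓘(ℝ, E) y₀).symm q.2.1)))
      (Icc (0 : ℝ) 1 ×ˢ ((extChartAt 𝓘(ℝ, E) y₀).target ×ˢ univ)) :=
    (contDiff_fst.contMDiff.contMDiffOn).prodMk
      (((contDiff_snd.comp contDiff_snd).contMDiff.contMDiffOn).prodMk
        ((contMDiffOn_extChartAt_symm y₀).comp
          (contDiff_fst.comp contDiff_snd).contMDiff.contMDiffOn fun q hq => hq.2.1))
  exact hh.comp h1 fun q hq => ⟨hq.1, mem_univ _⟩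

/-- Local Lipschitz estimate in the state and the parameter. -/
theorem exists_scalar_lipschitz [FiniteDimensional ℝ E]
    (hh : ContMDiffOn (𝓘(ℝ, ℝ).prod (𝓘(ℝ, ℝ).prod 𝓘(ℝ, E))) 𝓘(ℝ, ℝ) ∞
      (fun q : ℝ × (ℝ × Y) => h q.1 q.2.1 q.2.2) (Icc (0 : ℝ) 1 ×ˢ univ)) (y₀ : Y) (a : ℝ) :
    ∃ r > 0, Metric.ball (extChartAt 𝓘(ℝ, E) y₀ y₀) r ⊆ (extChartAt 𝓘(ℝ, E) y₀).target ∧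
      ∃ K : NNReal, ∀ t ∈ Icc (0 : ℝ) 1, ∀ σ ∈ Icc (-a) a, ∀ σ' ∈ Icc (-a) a,
      ∀ p ∈ Metric.ball (extChartAt 𝓘(ℝ, E) y₀ y₀) r,
      ∀ p' ∈ Metric.ball (extChartAt 𝓘(ℝ, E) y₀ y₀) r,
      |h t σ ((extChartAt 𝓘(ℝ, E) y₀).symm p) - h t σ' ((extChartAt 𝓘(ℝ, E) y₀).symm p')|
        ≤ K * (|σ - σ'| + ‖p - p'‖) := by
  have : ProperSpace E := FiniteDimensional.proper ℝ E
  obtain ⟨r, hr, hball⟩ := Metric.nhds_basis_closedBall.mem_iff.1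
    (extChartAt_target_mem_nhds (I := 𝓘(ℝ, E)) y₀)
  have hs : ContDiffOn ℝ ∞
      (fun q : ℝ × (E × ℝ) => h q.1 q.2.2 ((extChartAt 𝓘(ℝ, E) y₀).symm q.2.1))
      (Icc (0 : ℝ) 1 ×ˢ (Metric.closedBall (extChartAt 𝓘(ℝ, E) y₀ y₀) r ×ˢ Icc (-a) a)) :=
    (contDiffOn_scalar_inChart hh y₀).mono (prod_mono_right (prod_mono hball (subset_univ _)))
  obtain ⟨K, hK⟩ := hs.exists_lipschitzOnWith (by simp)
    ((convex_Icc _ _).prod ((convex_closedBall _ _).prod (convex_Icc _ _)))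
    (isCompact_Icc.prod ((isCompact_closedBall _ _).prod isCompact_Icc))
  refine ⟨r, hr, Metric.ball_subset_closedBall.trans hball, K, ?_⟩
  intro t ht σ hσ σ' hσ' p hp p' hp'
  have := hK.dist_le_mul (t, (p, σ)) ⟨ht, Metric.ball_subset_closedBall hp, hσ⟩
    (t, (p', σ')) ⟨ht, Metric.ball_subset_closedBall hp', hσ'⟩
  rw [Real.dist_eq] at this
  refine this.trans (mul_le_mul_of_nonneg_left ?_ K.2)
  rw [Prod.dist_eq, Prod.dist_eq, dist_self, Real.dist_eq, dist_eq_norm]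
  exact max_le (by positivity) (max_le (by simp) (by simp))

theorem exists_scalar_lipschitz_point [FiniteDimensional ℝ E]
    (hh : ContMDiffOn (𝓘(ℝ, ℝ).prod (𝓘(ℝ, ℝ).prod 𝓘(ℝ, E))) 𝓘(ℝ, ℝ) ∞
      (fun q : ℝ × (ℝ × Y) => h q.1 q.2.1 q.2.2) (Icc (0 : ℝ) 1 ×ˢ univ)) (y : Y) (a : ℝ) :
    ∃ K : NNReal, ∀ t ∈ Icc (0 : ℝ) 1, ∀ σ ∈ Icc (-a) a, ∀ σ' ∈ Icc (-a) a,
      |h t σ y - h t σ' y| ≤ K * |σ - σ'| := by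
  obtain ⟨r, hr, -, K, hK⟩ := exists_scalar_lipschitz hh y a
  refine ⟨K, fun t ht σ hσ σ' hσ' => ?_⟩
  have := hK t ht σ hσ σ' hσ' _ (Metric.mem_ball_self hr) _ (Metric.mem_ball_self hr)
  rwa [extChartAt_to_inv, sub_self, norm_zero, add_zero] at this

omit [TopologicalSpace Y] in
theorem IsScalarSolution.abs_le {M : ℝ} (hM : ∀ t ∈ Icc (0 : ℝ) 1, ∀ σ y, |h t σ y| ≤ M)
    {y : Y} {τ : ℝ → ℝ} (hτ : IsScalarSolution h y τ) :
    ∀ t ∈ Icc (0 : ℝ) 1, τ t ∈ Icc (-M) M := by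
  intro t ht
  have hM0 : 0 ≤ M := (abs_nonneg _).trans (hM 0 (by simp) 0 y)
  have := norm_le_mul_gronwallBound le_rfl hM0 hτ.2 hτ.1
    (fun t ht => by simpa using hM t ht (τ t) y) t ht
  rw [gronwallBound_K0] at this
  exact _root_.abs_le.1 (by simpa using this)

theorem IsScalarSolution.unique [FiniteDimensional ℝ E]
    (hh : ContMDiffOn (𝓘(ℝ, ℝ).prod (𝓘(ℝ, ℝ).prod 𝓘(ℝ, E))) 𝓘(ℝ, ℝ) ∞
      (fun q : ℝ × (ℝ × Y) => h q.1 q.2.1 q.2.2) (Icc (0 : ℝ) 1 ×ˢ univ))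
    {M : ℝ} (hM : ∀ t ∈ Icc (0 : ℝ) 1, ∀ σ y, |h t σ y| ≤ M)
    {y : Y} {τ τ' : ℝ → ℝ} (hτ : IsScalarSolution h y τ) (hτ' : IsScalarSolution h y τ') :
    ∀ t ∈ Icc (0 : ℝ) 1, τ t = τ' t := by
  intro t ht
  obtain ⟨K, hK⟩ := exists_scalar_lipschitz_point hh y M
  have := norm_le_mul_gronwallBound (z := fun t => τ t - τ' t) K.2 le_rfl
    (fun t ht => (hτ.2 t ht).sub (hτ'.2 t ht)) (by simp [hτ.1, hτ'.1])
    (fun t ht => by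
      simpa using hK t ht _ (hτ.abs_le hM t ht) _ (hτ'.abs_le hM t ht)) t ht
  rw [zero_mul] at this
  exact sub_eq_zero.1 (norm_le_zero_iff.1 this)

/-- A speed of at most `M` keeps the solution in `[-M, M]` during unit time, so Picard-Lindelöf on
that interval covers all of `[0, 1]`. -/
theorem exists_isScalarSolution [FiniteDimensional ℝ E]
    (hh : ContMDiffOn (𝓘(ℝ, ℝ).prod (𝓘(ℝ, ℝ).prod 𝓘(ℝ, E))) 𝓘(ℝ, ℝ) ∞
      (fun q : ℝ × (ℝ × Y) => h q.1 q.2.1 q.2.2) (Icc (0 : ℝ) 1 ×ˢ univ))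
    {M : ℝ} (hM : ∀ t ∈ Icc (0 : ℝ) 1, ∀ σ y, |h t σ y| ≤ M) (y : Y) :
    ∃ τ, IsScalarSolution h y τ := by
  have hM0 : 0 ≤ M := (abs_nonneg _).trans (hM 0 (by simp) 0 y)
  obtain ⟨K, hK⟩ := exists_scalar_lipschitz_point hh y M
  have hball : Metric.closedBall (0 : ℝ) M = Icc (-M) M := by
    rw [Real.closedBall_eq_Icc, zero_sub, zero_add]
  have hpl : IsPicardLindelof (fun t σ => h t σ y) (tmin := 0) (tmax := 1) ⟨0, by simp⟩
      (0 : ℝ) ⟨M, hM0⟩ 0 ⟨M, hM0⟩ K := by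
    refine ⟨fun t ht => ?_, fun x _ => ?_, fun t ht x _ => hM t ht x y, by simp⟩
    · change LipschitzOnWith K _ (Metric.closedBall (0 : ℝ) M)
      rw [hball]
      exact LipschitzOnWith.of_dist_le_mul fun σ hσ σ' hσ' => hK t ht σ hσ σ' hσ'
    · exact hh.continuousOn.comp (f := fun t : ℝ => (t, (x, y))) (by fun_prop)
        fun t ht => ⟨ht, mem_univ _⟩
  obtain ⟨τ, hτ0, hτ⟩ := hpl.exists_eq_forall_mem_Icc_hasDerivWithinAt₀
  exact ⟨τ, hτ0, hτ⟩

/-- Solutions of a smooth scalar differential equation depend smoothly on the parameter `y`. -/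
theorem contMDiffOn_of_isScalarSolution [FiniteDimensional ℝ E]
    (hh : ContMDiffOn (𝓘(ℝ, ℝ).prod (𝓘(ℝ, ℝ).prod 𝓘(ℝ, E))) 𝓘(ℝ, ℝ) ∞
      (fun q : ℝ × (ℝ × Y) => h q.1 q.2.1 q.2.2) (Icc (0 : ℝ) 1 ×ˢ univ))
    {M : ℝ} (hM : ∀ t ∈ Icc (0 : ℝ) 1, ∀ σ y, |h t σ y| ≤ M) {τ : ℝ → Y → ℝ}
    (hτ : ∀ y, IsScalarSolution h y (fun t => τ t y)) :
    ContMDiffOn (𝓘(ℝ, ℝ).prod 𝓘(ℝ, E)) 𝓘(ℝ, ℝ) ∞ (fun q : ℝ × Y => τ q.1 q.2)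
      (Icc (0 : ℝ) 1 ×ˢ univ) := by
  rintro ⟨t₀, y₀⟩ ⟨ht₀, -⟩
  obtain ⟨r, hr, hball, K, hK⟩ := exists_scalar_lipschitz hh y₀ M
  set c := extChartAt 𝓘(ℝ, E) y₀ with hc
  set U := Metric.ball (c y₀) r with hU
  -- Grönwall on the difference of two solutions gives a Lipschitz bound in the parameter, uniform
  -- in time. With continuity in time this yields joint continuity, the entry requirement of
  -- `IsODEFamily`.
  have hlip : ∀ t ∈ Icc (0 : ℝ) 1, ∀ p ∈ U, ∀ p' ∈ U, |τ t (c.symm p) - τ t (c.symm p')|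
      ≤ (K * gronwallBound 0 K 1 1) * ‖p - p'‖ := by
    intro t ht p hp p' hp'
    have := norm_le_mul_gronwallBound (z := fun t => τ t (c.symm p) - τ t (c.symm p')) (K := K)
      (ε := K * ‖p - p'‖) K.2 (by positivity)
      (fun t ht => ((hτ _).2 t ht).sub ((hτ _).2 t ht)) (by simp [(hτ _).1])
      (fun t ht => by
        have := hK t ht _ ((hτ (c.symm p)).abs_le hM t ht) _
          ((hτ (c.symm p')).abs_le hM t ht) p hp p' hp'
        rw [← mul_add]
        exact this) t ht
    rw [Real.norm_eq_abs] at this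
    linarith
  have hcont : ContinuousOn (fun q : ℝ × E => τ q.1 (c.symm q.2)) (Icc (0 : ℝ) 1 ×ˢ U) := by
    have hC : 0 ≤ K * gronwallBound 0 K 1 1 :=
      mul_nonneg K.2 (gronwallBound_zero_one_nonneg K.2)
    refine continuousOn_prod_of_continuousOn_lipschitzOnWith' _
      ⟨K * gronwallBound 0 K 1 1, hC⟩ (fun t ht => ?_) (fun p hp t ht => ?_)
    · refine LipschitzOnWith.of_dist_le_mul fun p hp p' hp' => ?_
      rw [Real.dist_eq, dist_eq_norm]
      exact hlip t ht p hp p' hp'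
    · exact ((hτ (c.symm p)).2 t ht).continuousWithinAt
  -- The constant zero component in `E` only lifts the state space `ℝ` to the universe of the
  -- parameter space.
  have hfam : IsODEFamily (P := E) (G := E × ℝ)
      (fun q => ((0 : E), h q.1 q.2.2.2 (c.symm q.2.1)))
      (c.target ×ˢ univ) U (fun t p => ((0 : E), τ t (c.symm p))) := by
    refine ⟨fun p _ => ?_, fun t _ p hp => ⟨hball hp, mem_univ _⟩,
      continuousOn_const.prodMk hcont, fun t ht p _ => ?_⟩
    · exact Prod.ext rfl (hτ (c.symm p)).1
    · exact (hasDerivWithinAt_const t _ (0 : E)).prodMk ((hτ (c.symm p)).2 t ht)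
  have hf : ContDiffOn ℝ ∞ (fun q : ℝ × (E × (E × ℝ)) => ((0 : E), h q.1 q.2.2.2 (c.symm q.2.1)))
      (Icc (0 : ℝ) 1 ×ˢ (c.target ×ˢ univ)) := by
    refine contDiffOn_const.prodMk ?_
    have h1 : ContDiff ℝ ∞ (fun q : ℝ × (E × (E × ℝ)) => (q.1, (q.2.1, q.2.2.2))) := by
      fun_prop
    exact (contDiffOn_scalar_inChart hh y₀).comp h1.contDiffOn
      fun q hq => ⟨hq.1, hq.2.1, mem_univ _⟩
  have hsm := (hfam.contDiffOn ((isOpen_extChartAt_target y₀).prod isOpen_univ)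
    Metric.isOpen_ball hf).snd
  have hW : c.source ∩ c ⁻¹' U ∈ 𝓝 y₀ :=
    ((continuousOn_extChartAt y₀).isOpen_inter_preimage (isOpen_extChartAt_source y₀)
      Metric.isOpen_ball).mem_nhds ⟨mem_extChartAt_source y₀, Metric.mem_ball_self hr⟩
  have hcc : ContMDiffOn 𝓘(ℝ, E) 𝓘(ℝ, E) ∞ c c.source := by
    rw [hc, extChartAt_source]; exact contMDiffOn_extChartAt
  have h1 : ContMDiffOn (𝓘(ℝ, ℝ).prod 𝓘(ℝ, E)) 𝓘(ℝ, ℝ × E) ∞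
      (fun q : ℝ × Y => (q.1, c q.2)) (Icc (0 : ℝ) 1 ×ˢ (c.source ∩ c ⁻¹' U)) :=
    contMDiffOn_fst.prodMk_space (hcc.comp contMDiffOn_snd fun q hq => hq.2.1)
  have h2 : ContMDiffOn (𝓘(ℝ, ℝ).prod 𝓘(ℝ, E)) 𝓘(ℝ, ℝ) ∞ (fun q : ℝ × Y => τ q.1 q.2)
      (Icc (0 : ℝ) 1 ×ˢ (c.source ∩ c ⁻¹' U)) := by
    refine ((contMDiffOn_iff_contDiffOn.2 hsm).comp h1 fun q hq => ⟨hq.1, hq.2.2⟩).congr ?_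
    intro q hq
    simp only [comp_apply, c.left_inv hq.2.1]
  have h3 : Icc (0 : ℝ) 1 ×ˢ (c.source ∩ c ⁻¹' U) ∈ 𝓝[Icc (0 : ℝ) 1 ×ˢ univ] (t₀, y₀) := by
    rw [nhdsWithin_prod_eq, nhdsWithin_univ]
    exact prod_mem_prod self_mem_nhdsWithin hW
  exact (h2 (t₀, y₀) ⟨ht₀, mem_of_mem_nhds hW⟩).mono_of_mem_nhdsWithin h3

end ScalarODE

/-! ### The flow of a time-dependent multiple of a fixed field -/

section TimeFlow

open Filter Topology Function

universe u

variable {E : Type u} [NormedAddCommGroup E] [NormedSpace ℝ E]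
  {Y : Type*} [TopologicalSpace Y] [ChartedSpace E Y] [IsManifold 𝓘(ℝ, E) ∞ Y]

/-- The time `t` map of the time-dependent vector field `K t • X`, where `Φ` is the flow of `X`. It
moves the points along the flow lines of `X`. -/
noncomputable def timeFlow (Φ : ℝ → Y → Y) (K : ℝ → Y → ℝ) (t : ℝ) (y : Y) : Y :=
  Φ (Classical.epsilon (IsScalarSolution (fun t σ y => K t (Φ σ y)) y) t) y

variable {X : VecField E Y} {Φ : ℝ → Y → Y} {K : ℝ → Y → ℝ}

omit [IsManifold 𝓘(ℝ, E) ∞ Y] in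
theorem SmoothTimeFunction.exists_bound [CompactSpace Y] (hK : SmoothTimeFunction E K) :
    ∃ M, ∀ t ∈ Icc (0 : ℝ) 1, ∀ y, |K t y| ≤ M := by
  obtain ⟨M, hM⟩ := (isCompact_Icc.prod isCompact_univ).exists_bound_of_continuousOn
    (ContMDiffOn.continuousOn hK)
  exact ⟨M, fun t ht y => hM (t, y) ⟨ht, mem_univ _⟩⟩

omit [IsManifold 𝓘(ℝ, E) ∞ Y] in
theorem IsSmoothFlow.contMDiffOn_speed (hΦ : IsSmoothFlow X Φ) (hK : SmoothTimeFunction E K) :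
    ContMDiffOn (𝓘(ℝ, ℝ).prod (𝓘(ℝ, ℝ).prod 𝓘(ℝ, E))) 𝓘(ℝ, ℝ) ∞
      (fun q : ℝ × (ℝ × Y) => K q.1 (Φ q.2.1 q.2.2)) (Icc (0 : ℝ) 1 ×ˢ univ) :=
  ContMDiffOn.comp hK (contMDiffOn_fst.prodMk (hΦ.smooth.comp contMDiff_snd).contMDiffOn)
    fun _ hq => ⟨hq.1, mem_univ _⟩

variable [FiniteDimensional ℝ E] [CompactSpace Y]

theorem IsSmoothFlow.isScalarSolution (hΦ : IsSmoothFlow X Φ) (hK : SmoothTimeFunction E K)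
    (y : Y) : IsScalarSolution (fun t σ y => K t (Φ σ y)) y
      (Classical.epsilon (IsScalarSolution (fun t σ y => K t (Φ σ y)) y)) := by
  obtain ⟨M, hM⟩ := hK.exists_bound
  exact Classical.epsilon_spec
    (exists_isScalarSolution (hΦ.contMDiffOn_speed hK) (fun t ht σ y => hM t ht _) y)

/-- By uniqueness the solution picked by choice in `timeFlow` may be replaced on `[0, 1]` by any
explicit one. -/
theorem IsSmoothFlow.timeFlow_eq (hΦ : IsSmoothFlow X Φ) (hK : SmoothTimeFunction E K)
    {y : Y} {τ : ℝ → ℝ} (hτ : IsScalarSolution (fun t σ y => K t (Φ σ y)) y τ)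
    {t : ℝ} (ht : t ∈ Icc (0 : ℝ) 1) : timeFlow Φ K t y = Φ (τ t) y := by
  obtain ⟨M, hM⟩ := hK.exists_bound
  rw [timeFlow, (hΦ.isScalarSolution hK y).unique (hΦ.contMDiffOn_speed hK)
    (fun t ht σ y => hM t ht _) hτ t ht]

theorem IsSmoothFlow.timeFlow_zero (hΦ : IsSmoothFlow X Φ) (hK : SmoothTimeFunction E K) (y : Y) :
    timeFlow Φ K 0 y = y := by
  rw [timeFlow, (hΦ.isScalarSolution hK y).1, hΦ.zero]

theorem IsSmoothFlow.contMDiffOn_timeFlow (hΦ : IsSmoothFlow X Φ) (hK : SmoothTimeFunction E K) :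
    ContMDiffOn (𝓘(ℝ, ℝ).prod 𝓘(ℝ, E)) 𝓘(ℝ, E) ∞ (fun p : ℝ × Y => timeFlow Φ K p.1 p.2)
      (Icc (0 : ℝ) 1 ×ˢ univ) := by
  obtain ⟨M, hM⟩ := hK.exists_bound
  exact hΦ.smooth.comp_contMDiffOn ((contMDiffOn_of_isScalarSolution (hΦ.contMDiffOn_speed hK)
    (fun t ht σ y => hM t ht _) (hΦ.isScalarSolution hK)).prodMk contMDiffOn_snd)

theorem IsSmoothFlow.contMDiff_timeFlow (hΦ : IsSmoothFlow X Φ) (hK : SmoothTimeFunction E K)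
    {t : ℝ} (ht : t ∈ Icc (0 : ℝ) 1) : ContMDiff 𝓘(ℝ, E) 𝓘(ℝ, E) ∞ (timeFlow Φ K t) :=
  contMDiffOn_univ.1 ((hΦ.contMDiffOn_timeFlow hK).comp
    (contMDiff_const.prodMk contMDiff_id).contMDiffOn fun y _ => ⟨ht, mem_univ y⟩)

omit [IsManifold 𝓘(ℝ, E) ∞ Y] [FiniteDimensional ℝ E] [CompactSpace Y] in
theorem SmoothTimeFunction.reverse (hK : SmoothTimeFunction E K) :
    SmoothTimeFunction E (fun t y => - K (1 - t) y) := by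
  have h1 : ContMDiff (𝓘(ℝ, ℝ).prod 𝓘(ℝ, E)) (𝓘(ℝ, ℝ).prod 𝓘(ℝ, E)) ∞
      (fun p : ℝ × Y => (1 - p.1, p.2)) :=
    ((contDiff_const.sub contDiff_id).contMDiff.comp contMDiff_fst).prodMk contMDiff_snd
  have h2 : ContMDiff 𝓘(ℝ, ℝ) 𝓘(ℝ, ℝ) ∞ (fun x : ℝ => -x) := contDiff_neg.contMDiff
  refine h2.comp_contMDiffOn (ContMDiffOn.comp hK h1.contMDiffOn fun p hp => ⟨?_, mem_univ _⟩)
  have := hp.1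
  exact ⟨by linarith [this.2], by linarith [this.1]⟩

omit [IsManifold 𝓘(ℝ, E) ∞ Y] [FiniteDimensional ℝ E] [CompactSpace Y] in
theorem SmoothTimeFunction.rescale (hK : SmoothTimeFunction E K) {t : ℝ}
    (ht : t ∈ Icc (0 : ℝ) 1) : SmoothTimeFunction E (fun s y => t * K (t * s) y) := by
  have h1 : ContMDiff (𝓘(ℝ, ℝ).prod 𝓘(ℝ, E)) (𝓘(ℝ, ℝ).prod 𝓘(ℝ, E)) ∞
      (fun p : ℝ × Y => (t * p.1, p.2)) :=
    ((contDiff_const.mul contDiff_id).contMDiff.comp contMDiff_fst).prodMk contMDiff_snd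
  have h2 : ContMDiff 𝓘(ℝ, ℝ) 𝓘(ℝ, ℝ) ∞ (fun x : ℝ => t * x) :=
    (contDiff_const.mul contDiff_id).contMDiff
  exact h2.comp_contMDiffOn (ContMDiffOn.comp hK h1.contMDiffOn fun p hp =>
    ⟨⟨mul_nonneg ht.1 hp.1.1, mul_le_one₀ ht.2 hp.1.1 hp.1.2⟩, mem_univ _⟩)

/-- Running the clock backwards from the end point: `s ↦ τ (1 - s) - τ 1` solves the reversed
equation, because by the group law it moves `Φ (τ 1) y` to `Φ (τ (1 - s)) y`. At `s = 1` it undoes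
`τ 1`. -/
theorem IsSmoothFlow.timeFlow_reverse (hΦ : IsSmoothFlow X Φ) (hK : SmoothTimeFunction E K)
    (y : Y) : timeFlow Φ (fun t y => - K (1 - t) y) 1 (timeFlow Φ K 1 y) = y := by
  obtain ⟨h0, hd⟩ := hΦ.isScalarSolution hK y
  rw [timeFlow.eq_def Φ K]
  set τ := Classical.epsilon (IsScalarSolution (fun t σ y => K t (Φ σ y)) y)
  have hmaps : MapsTo (fun s : ℝ => 1 - s) (Icc 0 1) (Icc 0 1) := fun s hs =>
    ⟨by linarith [hs.2], by linarith [hs.1]⟩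
  have hρ : IsScalarSolution (fun t σ y => - K (1 - t) (Φ σ y)) (Φ (τ 1) y)
      (fun s => τ (1 - s) - τ 1) := by
    refine ⟨by simp, fun s hs => ?_⟩
    have h1 := ((hd (1 - s) (hmaps hs)).scomp s
      ((hasDerivWithinAt_id s (Icc (0 : ℝ) 1)).const_sub 1) hmaps).sub_const (τ 1)
    refine h1.congr_deriv ?_
    simp [hΦ.add]
  rw [hΦ.timeFlow_eq hK.reverse hρ (by simp), hΦ.add, sub_self, h0, zero_sub, neg_add_cancel,
    hΦ.zero]

theorem IsSmoothFlow.timeFlow_reverse' (hΦ : IsSmoothFlow X Φ) (hK : SmoothTimeFunction E K)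
    (y : Y) : timeFlow Φ K 1 (timeFlow Φ (fun t y => - K (1 - t) y) 1 y) = y := by
  simpa using hΦ.timeFlow_reverse hK.reverse y

/-- Rescaling time turns every time `t` map into a time-one map, so reversal at time `1` suffices to
invert all of them, including `t = 0`. -/
theorem IsSmoothFlow.timeFlow_rescale (hΦ : IsSmoothFlow X Φ) (hK : SmoothTimeFunction E K)
    {t : ℝ} (ht : t ∈ Icc (0 : ℝ) 1) (y : Y) :
    timeFlow Φ (fun s y => t * K (t * s) y) 1 y = timeFlow Φ K t y := by
  obtain ⟨h0, hd⟩ := hΦ.isScalarSolution hK y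
  rw [timeFlow.eq_def Φ K]
  set τ := Classical.epsilon (IsScalarSolution (fun t σ y => K t (Φ σ y)) y)
  have hmaps : MapsTo (fun s : ℝ => t * s) (Icc 0 1) (Icc 0 1) := fun s hs =>
    ⟨mul_nonneg ht.1 hs.1, mul_le_one₀ ht.2 hs.1 hs.2⟩
  have hρ : IsScalarSolution (fun s σ y => t * K (t * s) (Φ σ y)) y (fun s => τ (t * s)) := by
    refine ⟨by simpa using h0, fun s hs => ?_⟩
    have h1 := (hd (t * s) (hmaps hs)).scomp s
      ((hasDerivWithinAt_id s (Icc (0 : ℝ) 1)).const_mul t) hmaps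
    refine h1.congr_deriv ?_
    simp
  rw [hΦ.timeFlow_eq (hK.rescale ht) hρ (by simp), mul_one]

/-- The time `t` map of `K t • X` as a diffeomorphism. -/
noncomputable def IsSmoothFlow.timeDiffeo (hΦ : IsSmoothFlow X Φ) (hK : SmoothTimeFunction E K)
    {t : ℝ} (ht : t ∈ Icc (0 : ℝ) 1) : Diffeomorph 𝓘(ℝ, E) 𝓘(ℝ, E) Y Y ∞ where
  toFun := timeFlow Φ K t
  invFun := timeFlow Φ (fun s y => - (t * K (t * (1 - s)) y)) 1
  left_inv y := by
    rw [← hΦ.timeFlow_rescale hK ht]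
    exact hΦ.timeFlow_reverse (hK.rescale ht) y
  right_inv y := by
    rw [← hΦ.timeFlow_rescale hK ht]
    exact hΦ.timeFlow_reverse' (hK.rescale ht) y
  contMDiff_toFun := hΦ.contMDiff_timeFlow hK ht
  contMDiff_invFun := hΦ.contMDiff_timeFlow (hK.rescale ht).reverse (by simp)

end TimeFlow

/-! ### The normalized section of the line field -/

section Transverse

open Filter Topology Function

variable {E : Type*} [NormedAddCommGroup E] [NormedSpace ℝ E]
  {Y : Type*} [TopologicalSpace Y] [ChartedSpace E Y] [IsManifold 𝓘(ℝ, E) ∞ Y]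

/-- A line field transverse to the kernel of a smooth one-form has a smooth section on which the
form is equal to one. -/
theorem PlaneField.IsSmoothLineField.exists_normalized_section {L : PlaneField E Y}
    (hL : L.IsSmoothLineField) {lam : OneForm E Y} (hlam : lam.SmoothOn univ)
    (hdisj : ∀ y, Disjoint (L y) (lam.kerField y)) :
    ∃ R : VecField E Y, R.SmoothOn univ ∧ ∀ y, R y ∈ L y ∧ lam y (R y) = 1 := by
  have hne : ∀ y, ∀ v ∈ L y, v ≠ 0 → lam y v ≠ 0 := fun y v hv hv0 h =>
    hv0 ((Submodule.disjoint_def.1 (hdisj y)) v hv h)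
  have hex : ∀ y, ∃ r ∈ L y, lam y r = 1 := by
    intro y
    obtain ⟨U, -, hyU, X, -, hX⟩ := hL y
    obtain ⟨hX0, hXL⟩ := hX y hyU
    have hXm : X y ∈ L y := hXL ▸ Submodule.mem_span_singleton_self _
    refine ⟨(lam y (X y))⁻¹ • X y, (L y).smul_mem _ hXm, ?_⟩
    rw [map_smul, smul_eq_mul, inv_mul_cancel₀ (hne y _ hXm hX0)]
  choose R hRL hR1 using hex
  refine ⟨R, ?_, fun y => ⟨hRL y, hR1 y⟩⟩
  intro y _
  obtain ⟨U, hU, hyU, X, hXs, hX⟩ := hL y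
  have hXm : ∀ z ∈ U, X z ∈ L z := fun z hz => (hX z hz).2 ▸ Submodule.mem_span_singleton_self _
  have h1 : ContMDiffOn 𝓘(ℝ, E) 𝓘(ℝ, ℝ) ∞ (fun z => (lam z (X z))⁻¹) U := by
    have : ContMDiffOn 𝓘(ℝ, E) 𝓘(ℝ, ℝ) ∞ (fun z => lam z (X z)) U :=
      (contMDiffOn_pairing hlam.smoothPath hXs).comp
        ((contMDiff_const (c := (0 : ℝ))).prodMk contMDiff_id).contMDiffOn fun z hz => ⟨by simp, hz⟩
    exact this.inv₀ fun z hz => hne z _ (hXm z hz) (hX z hz).1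
  have h2 : VecField.SmoothOn (fun z => (lam z (X z))⁻¹ • X z) U := h1.smul_section hXs
  -- A line contains only one vector on which `λ` is `1`, so the pointwise choice `R` agrees with
  -- the smooth local section `X / λ(X)`.
  have h3 : VecField.SmoothOn R U := by
    refine h2.congr fun z hz => ?_
    have hz1 := hRL z
    rw [(hX z hz).2, Submodule.mem_span_singleton] at hz1
    obtain ⟨a, ha⟩ := hz1
    have hz2 := hR1 z
    rw [← ha, map_smul, smul_eq_mul] at hz2
    rw [← ha, eq_inv_of_mul_eq_one_left hz2]
  exact (h3.contMDiffAt (hU.mem_nhds hyU)).contMDiffWithinAt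

end Transverse

/-! ### Derivative of a pullback in coordinates -/

section Transport

open Filter Topology Function

/-- The derivative of a path of one-forms along a curve, evaluated on the derivative of a flow. -/
theorem hasDerivAt_pullback {E : Type*} [NormedAddCommGroup E] [NormedSpace ℝ E]
    {Λ : ℝ × E → (E →L[ℝ] ℝ)} {ψ : ℝ × E → E} {V : E → E} {t : ℝ} {p : E}
    (hΛ : DifferentiableAt ℝ Λ (t, ψ (t, p))) (hψ : ContDiffAt ℝ ∞ ψ (t, p))
    (hV : DifferentiableAt ℝ V (ψ (t, p)))
    (hψV : ∀ᶠ p' in 𝓝 p, fderiv ℝ ψ (t, p') (1, 0) = V (ψ (t, p'))) (w : E) :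
    HasDerivAt (fun s => Λ (s, ψ (s, p)) (fderiv ℝ ψ (s, p) (0, w)))
      (fderiv ℝ Λ (t, ψ (t, p)) (1, V (ψ (t, p))) (fderiv ℝ ψ (t, p) (0, w))
        + Λ (t, ψ (t, p)) (fderiv ℝ V (ψ (t, p)) (fderiv ℝ ψ (t, p) (0, w)))) t := by
  have hψd : DifferentiableAt ℝ ψ (t, p) := hψ.differentiableAt (by simp)
  have hψ2 : DifferentiableAt ℝ (fderiv ℝ ψ) (t, p) :=
    (hψ.fderiv_right (m := ∞) (by simp)).differentiableAt (by simp)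
  have hline : HasDerivAt (fun s : ℝ => (s, p)) ((1 : ℝ), (0 : E)) t :=
    (hasDerivAt_id t).prodMk (hasDerivAt_const t p)
  have h1 : HasDerivAt (fun s => ψ (s, p)) (V (ψ (t, p))) t := by
    rw [← hψV.self_of_nhds]
    exact hψd.hasFDerivAt.comp_hasDerivAt t hline
  have h2 : HasDerivAt (fun s => Λ (s, ψ (s, p)))
      (fderiv ℝ Λ (t, ψ (t, p)) (1, V (ψ (t, p)))) t :=
    hΛ.hasFDerivAt.comp_hasDerivAt t ((hasDerivAt_id t).prodMk h1)
  have h3 : HasDerivAt (fun s => fderiv ℝ ψ (s, p) (0, w))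
      (fderiv ℝ (fderiv ℝ ψ) (t, p) (1, 0) (0, w)) t := by
    have h := hψ2.hasFDerivAt.comp_hasDerivAt t hline
    exact ((ContinuousLinearMap.apply ℝ E ((0 : ℝ), w)).hasFDerivAt).comp_hasDerivAt t h
  -- Symmetry of second derivatives: `∂_t ∂_p ψ (w) = ∂_p (V ∘ ψ)(w) = DV(∂_p ψ (w))`.
  have hsym : fderiv ℝ (fderiv ℝ ψ) (t, p) (1, 0) (0, w)
      = fderiv ℝ V (ψ (t, p)) (fderiv ℝ ψ (t, p) (0, w)) := by
    rw [(hψ.isSymmSndFDerivAt (by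
      rw [minSmoothness_of_isRCLikeNormedField]; exact WithTop.coe_le_coe.2 le_top)).eq]
    have hs : HasFDerivAt (fun p' : E => (t, p')) (ContinuousLinearMap.inr ℝ ℝ E) p :=
      hasFDerivAt_prodMk_right t p
    have h4 := ((ContinuousLinearMap.apply ℝ E ((1 : ℝ), (0 : E))).hasFDerivAt).comp p
      (hψ2.hasFDerivAt.comp p hs)
    have h5 := hV.hasFDerivAt.comp p (hψd.hasFDerivAt.comp p hs)
    exact congrArg (fun L : E →L[ℝ] E => L w) (h4.unique (h5.congr_of_eventuallyEq hψV))
  rw [← hsym]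
  exact h2.clm_apply h3

variable {E : Type*} [NormedAddCommGroup E] [NormedSpace ℝ E]
  {Y : Type*} [TopologicalSpace Y] [ChartedSpace E Y] [IsManifold 𝓘(ℝ, E) ∞ Y]

/-- A path of maps read in the charts at `y` and `z`. -/
noncomputable def chartRep (φ : ℝ → Y → Y) (y z : Y) (q : ℝ × E) : E :=
  extChartAt 𝓘(ℝ, E) z (φ q.1 ((extChartAt 𝓘(ℝ, E) y).symm q.2))

variable {φ : ℝ → Y → Y}

/-- The domain of the chart representation is only relatively open, since time runs in `[0, 1]`.
Writing it as a product cut by an open `O` keeps unique differentiability at the end times. -/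
theorem exists_contDiffOn_chartRep
    (hφ : ContMDiffOn (𝓘(ℝ, ℝ).prod 𝓘(ℝ, E)) 𝓘(ℝ, E) ∞ (fun p : ℝ × Y => φ p.1 p.2)
      (Icc (0 : ℝ) 1 ×ˢ univ)) (y z : Y) :
    ∃ O : Set (ℝ × E), IsOpen O ∧
      (∀ t ∈ Icc (0 : ℝ) 1, ∀ p ∈ (extChartAt 𝓘(ℝ, E) y).target, (t, p) ∈ O ↔
        φ t ((extChartAt 𝓘(ℝ, E) y).symm p) ∈ (extChartAt 𝓘(ℝ, E) z).source) ∧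
      ContDiffOn ℝ ∞ (chartRep φ y z)
        ((Icc (0 : ℝ) 1 ×ˢ (extChartAt 𝓘(ℝ, E) y).target) ∩ O) := by
  set c := extChartAt 𝓘(ℝ, E) y with hc
  set c' := extChartAt 𝓘(ℝ, E) z with hc'
  have h1 : ContMDiffOn 𝓘(ℝ, ℝ × E) (𝓘(ℝ, ℝ).prod 𝓘(ℝ, E)) ∞
      (fun q : ℝ × E => (q.1, c.symm q.2)) (Icc (0 : ℝ) 1 ×ˢ c.target) :=
    (contDiff_fst.contMDiff.contMDiffOn).prodMk
      ((contMDiffOn_extChartAt_symm y).comp contDiff_snd.contMDiff.contMDiffOn fun q hq => hq.2)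
  have h2 : ContMDiffOn 𝓘(ℝ, ℝ × E) 𝓘(ℝ, E) ∞
      (fun q : ℝ × E => φ q.1 (c.symm q.2)) (Icc (0 : ℝ) 1 ×ˢ c.target) :=
    hφ.comp h1 fun q hq => ⟨hq.1, mem_univ _⟩
  obtain ⟨O, hO, hO'⟩ := continuousOn_iff'.1 h2.continuousOn c'.source
    (isOpen_extChartAt_source z)
  have hmem : ∀ t ∈ Icc (0 : ℝ) 1, ∀ p ∈ c.target, (t, p) ∈ O ↔ φ t (c.symm p) ∈ c'.source := by
    intro t ht p hp
    have := Set.ext_iff.1 hO' (t, p)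
    simp only [mem_inter_iff, mem_preimage, mem_prod, ht, hp, and_true] at this
    exact this.symm
  refine ⟨O, hO, hmem, ?_⟩
  have hcc : ContMDiffOn 𝓘(ℝ, E) 𝓘(ℝ, E) ∞ c' c'.source := by
    rw [hc', extChartAt_source]; exact contMDiffOn_extChartAt
  rw [← contMDiffOn_iff_contDiffOn]
  exact hcc.comp (h2.mono inter_subset_left) fun q hq => (hmem q.1 hq.1.1 q.2 hq.1.2).1 hq.2

/-- The derivative of a smooth map, read in charts. -/
theorem hasFDerivAt_chartRep {t : ℝ} {y z : Y}
    (hφ : MDifferentiableAt 𝓘(ℝ, E) 𝓘(ℝ, E) (φ t) y)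
    (hz : φ t y ∈ (extChartAt 𝓘(ℝ, E) z).source) {D : E →L[ℝ] E}
    (hD : HasFDerivAt (fun p => chartRep φ y z (t, p)) D (extChartAt 𝓘(ℝ, E) y y))
    (w : TangentSpace 𝓘(ℝ, E) y) :
    D w = mfderiv 𝓘(ℝ, E) 𝓘(ℝ, E) (extChartAt 𝓘(ℝ, E) z) (φ t y)
      (mfderiv 𝓘(ℝ, E) 𝓘(ℝ, E) (φ t) y w) := by
  have h1 : HasMFDerivAt 𝓘(ℝ, E) 𝓘(ℝ, E) (extChartAt 𝓘(ℝ, E) y) y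
      (mfderiv 𝓘(ℝ, E) 𝓘(ℝ, E) (extChartAt 𝓘(ℝ, E) y) y) :=
    (mdifferentiableAt_extChartAt (mem_chart_source E y)).hasMFDerivAt
  have h2 : HasMFDerivAt 𝓘(ℝ, E) 𝓘(ℝ, E) (extChartAt 𝓘(ℝ, E) z) (φ t y)
      (mfderiv 𝓘(ℝ, E) 𝓘(ℝ, E) (extChartAt 𝓘(ℝ, E) z) (φ t y)) :=
    (mdifferentiableAt_extChartAt (by rwa [extChartAt_source] at hz)).hasMFDerivAt
  have h3 := h2.comp y hφ.hasMFDerivAt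
  have h4 := (hD.hasMFDerivAt.comp y h1).congr_of_eventuallyEq (f₁ := extChartAt 𝓘(ℝ, E) z ∘ φ t)
    (by
      filter_upwards [extChartAt_source_mem_nhds (I := 𝓘(ℝ, E)) y] with x hx
      simp only [comp_apply, chartRep, (extChartAt 𝓘(ℝ, E) y).left_inv hx])
  have h5 : (mfderiv 𝓘(ℝ, E) 𝓘(ℝ, E) (extChartAt 𝓘(ℝ, E) y) y : E →L[ℝ] E) w = w :=
    congrArg (fun L : E →L[ℝ] E => L w) mfderiv_extChartAt_self
  exact (congrArg D h5).symm.trans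
    (congrArg (fun L : E →L[ℝ] E => L w) (hasMFDerivAt_unique h4 h3))

end Transport

/-! ### The pulled back form as a function of time -/

section Pullback

open Filter Topology Function

variable {E : Type*} [NormedAddCommGroup E] [NormedSpace ℝ E]
  {Y : Type*} [TopologicalSpace Y] [ChartedSpace E Y] [IsManifold 𝓘(ℝ, E) ∞ Y]
  {φ : ℝ → Y → Y}

/-- The value `(φ t)^* (b t)` on a tangent vector `w` at `y`, as a function of `t`. -/
noncomputable def pullbackPath (b : ℝ → OneForm E Y) (φ : ℝ → Y → Y) (y : Y)
    (w : TangentSpace 𝓘(ℝ, E) y) (t : ℝ) : ℝ :=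
  b t (φ t y) (mfderiv 𝓘(ℝ, E) 𝓘(ℝ, E) (φ t) y w)

theorem pullbackPath_eq_inChart {b : ℝ → OneForm E Y} {t : ℝ} {y z : Y}
    (hφ : MDifferentiableAt 𝓘(ℝ, E) 𝓘(ℝ, E) (φ t) y)
    (hz : φ t y ∈ (extChartAt 𝓘(ℝ, E) z).source) {D : E →L[ℝ] E}
    (hD : HasFDerivAt (fun p => chartRep φ y z (t, p)) D (extChartAt 𝓘(ℝ, E) y y))
    (w : TangentSpace 𝓘(ℝ, E) y) :
    pullbackPath b φ y w t = (b t).inChart z (extChartAt 𝓘(ℝ, E) z (φ t y)) (D w) := by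
  rw [hasFDerivAt_chartRep hφ hz hD]
  have h1 := mfderiv_extChartAt_symm_comp z hz (mfderiv 𝓘(ℝ, E) 𝓘(ℝ, E) (φ t) y w)
  have h2 := (extChartAt 𝓘(ℝ, E) z).left_inv hz
  unfold pullbackPath OneForm.inChart
  rw [h2]
  exact (congrArg (b t (φ t y)) h1).symm

omit [IsManifold 𝓘(ℝ, E) ∞ Y] in
theorem chartRep_extChartAt (y z : Y) (t : ℝ) :
    chartRep φ y z (t, extChartAt 𝓘(ℝ, E) y y) = extChartAt 𝓘(ℝ, E) z (φ t y) := by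
  simp only [chartRep, extChartAt_to_inv]

omit [IsManifold 𝓘(ℝ, E) ∞ Y] in
theorem mdifferentiableAt_slice
    (hφ : ContMDiffOn (𝓘(ℝ, ℝ).prod 𝓘(ℝ, E)) 𝓘(ℝ, E) ∞ (fun p : ℝ × Y => φ p.1 p.2)
      (Icc (0 : ℝ) 1 ×ˢ univ)) {t : ℝ} (ht : t ∈ Icc (0 : ℝ) 1) (y : Y) :
    MDifferentiableAt 𝓘(ℝ, E) 𝓘(ℝ, E) (φ t) y := by
  have : ContMDiffOn 𝓘(ℝ, E) 𝓘(ℝ, E) ∞ (φ t) univ :=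
    hφ.comp ((contMDiff_const (c := t)).prodMk contMDiff_id).contMDiffOn
      fun y _ => ⟨ht, mem_univ y⟩
  exact (contMDiffOn_univ.1 this y).mdifferentiableAt (by simp)

/-- Near a time `t₀`, the pullback is computed by the derivative of the chart representation. -/
theorem exists_pullbackPath_eq
    (hφ : ContMDiffOn (𝓘(ℝ, ℝ).prod 𝓘(ℝ, E)) 𝓘(ℝ, E) ∞ (fun p : ℝ × Y => φ p.1 p.2)
      (Icc (0 : ℝ) 1 ×ˢ univ)) {t₀ : ℝ} (ht₀ : t₀ ∈ Icc (0 : ℝ) 1) (y : Y) :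
    ∃ S ∈ 𝓝[Icc (0 : ℝ) 1 ×ˢ univ] (t₀, extChartAt 𝓘(ℝ, E) y y), UniqueDiffOn ℝ S ∧
      S ⊆ Icc (0 : ℝ) 1 ×ˢ univ ∧
      ContDiffOn ℝ ∞ (chartRep φ y (φ t₀ y)) S ∧
      ∀ t, (t, extChartAt 𝓘(ℝ, E) y y) ∈ S →
        φ t y ∈ (extChartAt 𝓘(ℝ, E) (φ t₀ y)).source ∧
        ∀ (w : TangentSpace 𝓘(ℝ, E) y) (b : ℝ → OneForm E Y), pullbackPath b φ y w t
        = (b t).inChart (φ t₀ y) (chartRep φ y (φ t₀ y) (t, extChartAt 𝓘(ℝ, E) y y))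
          (fderivWithin ℝ (chartRep φ y (φ t₀ y)) S (t, extChartAt 𝓘(ℝ, E) y y) (0, w)) := by
  obtain ⟨O, hO, hOmem, hsm⟩ := exists_contDiffOn_chartRep hφ y (φ t₀ y)
  have htgt := isOpen_extChartAt_target (I := 𝓘(ℝ, E)) y
  have hp : extChartAt 𝓘(ℝ, E) y y ∈ (extChartAt 𝓘(ℝ, E) y).target := mem_extChartAt_target y
  set p := extChartAt 𝓘(ℝ, E) y y with hpdef
  set T := (extChartAt 𝓘(ℝ, E) y).target with hT
  have hpy : (extChartAt 𝓘(ℝ, E) y).symm p = y := extChartAt_to_inv y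
  have hmem : ∀ t ∈ Icc (0 : ℝ) 1, (t, p) ∈ O ↔ φ t y ∈ (extChartAt 𝓘(ℝ, E) (φ t₀ y)).source := by
    intro t ht
    rw [hOmem t ht p hp, hpy]
  refine ⟨(Icc (0 : ℝ) 1 ×ˢ T) ∩ O, ?_, (uniqueDiffOn_Icc_prod htgt).inter hO,
    fun q hq => ⟨hq.1.1, mem_univ _⟩, hsm, fun t ht => ⟨(hmem t ht.1.1).1 ht.2, fun w b => ?_⟩⟩
  · refine inter_mem ?_ (mem_nhdsWithin_of_mem_nhds (hO.mem_nhds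
      ((hmem t₀ ht₀).2 (mem_extChartAt_source _))))
    rw [nhdsWithin_prod_eq, nhdsWithin_univ]
    exact prod_mem_prod self_mem_nhdsWithin (htgt.mem_nhds hp)
  · have htI : t ∈ Icc (0 : ℝ) 1 := ht.1.1
    have h1 := ((hsm.differentiableOn (by simp)) (t, p) ht).hasFDerivWithinAt
    have hline : Continuous (fun x : E => (t, x)) := by fun_prop
    have hopen : T ∩ (fun x : E => (t, x)) ⁻¹' O ∈ 𝓝 p :=
      inter_mem (htgt.mem_nhds hp) (hline.continuousAt.preimage_mem_nhds (hO.mem_nhds ht.2))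
    have h2 : HasFDerivWithinAt (fun x : E => (t, x)) (ContinuousLinearMap.inr ℝ ℝ E)
        (T ∩ (fun x : E => (t, x)) ⁻¹' O) p := (hasFDerivAt_prodMk_right t p).hasFDerivWithinAt
    have h3 := (h1.comp p h2 fun x hx => ⟨⟨htI, hx.1⟩, hx.2⟩).hasFDerivAt hopen
    rw [chartRep_extChartAt]
    exact pullbackPath_eq_inChart (mdifferentiableAt_slice hφ htI y) ((hmem t htI).1 ht.2) h3 w

/-- The differential equation for the pullback is derived only on the open interval `(0, 1)`; this
continuity carries its conclusion to the end points. -/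
theorem continuousOn_pullbackPath {b : ℝ → OneForm E Y}
    (hb : ∀ z, ContDiffOn ℝ ∞ (fun q : ℝ × E => (b q.1).inChart z q.2)
      (Icc (0 : ℝ) 1 ×ˢ (extChartAt 𝓘(ℝ, E) z).target))
    (hφ : ContMDiffOn (𝓘(ℝ, ℝ).prod 𝓘(ℝ, E)) 𝓘(ℝ, E) ∞ (fun p : ℝ × Y => φ p.1 p.2)
      (Icc (0 : ℝ) 1 ×ˢ univ)) (y : Y) (w : TangentSpace 𝓘(ℝ, E) y) :
    ContinuousOn (pullbackPath b φ y w) (Icc 0 1) := by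
  intro t₀ ht₀
  obtain ⟨S, hS, hSu, hSI, hsm, heq⟩ := exists_pullbackPath_eq hφ ht₀ y
  set p := extChartAt 𝓘(ℝ, E) y y with hp
  have hline : ContinuousOn (fun t : ℝ => (t, p)) ((fun t : ℝ => (t, p)) ⁻¹' S) := by fun_prop
  have hmaps : MapsTo (fun t : ℝ => (t, p)) ((fun t : ℝ => (t, p)) ⁻¹' S) S := fun t ht => ht
  have hI : (fun t : ℝ => (t, p)) ⁻¹' S ∈ 𝓝[Icc 0 1] t₀ := by
    have h : Tendsto (fun t : ℝ => (t, p)) (𝓝[Icc 0 1] t₀) (𝓝 (t₀, p)) :=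
      (Continuous.tendsto (by fun_prop) t₀).mono_left nhdsWithin_le_nhds
    have h' : ∀ᶠ t in 𝓝[Icc 0 1] t₀, (t, p) ∈ Icc (0 : ℝ) 1 ×ˢ (univ : Set E) := by
      filter_upwards [self_mem_nhdsWithin] with t ht
      exact mk_mem_prod ht (mem_univ p)
    exact tendsto_nhdsWithin_of_tendsto_nhds_of_eventually_within _ h h' hS
  have hψ := hsm.continuousOn.comp hline hmaps
  have hD := (hsm.continuousOn_fderivWithin hSu (by simp)).comp hline hmaps
  have hΛ : ContinuousOn (fun t => (b t).inChart (φ t₀ y) (chartRep φ y (φ t₀ y) (t, p)))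
      ((fun t : ℝ => (t, p)) ⁻¹' S) := by
    refine (hb (φ t₀ y)).continuousOn.comp (continuousOn_id.prodMk hψ) fun t ht =>
      ⟨(hSI ht).1, ?_⟩
    change chartRep φ y (φ t₀ y) (t, p) ∈ _
    rw [chartRep_extChartAt]
    exact (extChartAt 𝓘(ℝ, E) (φ t₀ y)).map_source (heq t ht).1
  have hmem : (t₀, p) ∈ S := mem_of_mem_nhdsWithin (mk_mem_prod ht₀ (mem_univ p)) hS
  refine (((hΛ.clm_apply (hD.clm_apply continuousOn_const)).congr
    fun t ht => (heq t ht).2 w b) t₀ hmem).mono_of_mem_nhdsWithin hI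

/-- The right side is the coordinate form of `(ḃ_t + L_V b_t)(W)`, in the fixed chart at `φ t y`.
The field `V` has to be the velocity of `φ` at the single time `t` only, but at all nearby points.
-/
theorem hasDerivAt_pullbackPath {b : ℝ → OneForm E Y}
    (hb : ∀ z, ContDiffOn ℝ ∞ (fun q : ℝ × E => (b q.1).inChart z q.2)
      (Icc (0 : ℝ) 1 ×ˢ (extChartAt 𝓘(ℝ, E) z).target))
    (hφ : ContMDiffOn (𝓘(ℝ, ℝ).prod 𝓘(ℝ, E)) 𝓘(ℝ, E) ∞ (fun p : ℝ × Y => φ p.1 p.2)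
      (Icc (0 : ℝ) 1 ×ˢ univ)) {t : ℝ} (ht : t ∈ Ioo (0 : ℝ) 1) (y : Y)
    (w : TangentSpace 𝓘(ℝ, E) y) {V : E → E} {e : E} (he : e = extChartAt 𝓘(ℝ, E) (φ t y) (φ t y))
    (hV : DifferentiableAt ℝ V e)
    (hφV : ∀ y', φ t y' ∈ (extChartAt 𝓘(ℝ, E) (φ t y)).source →
      HasDerivAt (fun s => extChartAt 𝓘(ℝ, E) (φ t y) (φ s y'))
        (V (extChartAt 𝓘(ℝ, E) (φ t y) (φ t y'))) t) {W : E}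
    (hW : W = mfderiv 𝓘(ℝ, E) 𝓘(ℝ, E) (φ t) y w) :
    HasDerivAt (pullbackPath b φ y w)
      (fderiv ℝ (fun q : ℝ × E => (b q.1).inChart (φ t y) q.2) (t, e) (1, V e) W
        + (b t).inChart (φ t y) e (fderiv ℝ V e W)) t := by
  have htI : t ∈ Icc (0 : ℝ) 1 := Ioo_subset_Icc_self ht
  obtain ⟨S, hS, -, -, hsm, heq⟩ := exists_pullbackPath_eq hφ htI y
  set p := extChartAt 𝓘(ℝ, E) y y with hp
  set ψ : ℝ × E → E := chartRep φ y (φ t y) with hψ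
  have hS' : S ∈ 𝓝 (t, p) := by
    rwa [nhdsWithin_eq_nhds.2 (prod_mem_nhds (Icc_mem_nhds ht.1 ht.2) univ_mem)] at hS
  have hψtp : ψ (t, p) = e := by rw [he, hψ, hp, chartRep_extChartAt]
  have hψs : ContDiffAt ℝ ∞ ψ (t, p) := hsm.contDiffAt hS'
  have hΛ : DifferentiableAt ℝ (fun q : ℝ × E => (b q.1).inChart (φ t y) q.2) (t, e) := by
    refine ((hb (φ t y)).contDiffAt (prod_mem_nhds (Icc_mem_nhds ht.1 ht.2) ?_)).differentiableAt
      (by simp)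
    rw [he]
    exact extChartAt_target_mem_nhds (φ t y)
  have hcont : ∀ᶠ p' in 𝓝 p, φ t ((extChartAt 𝓘(ℝ, E) y).symm p')
      ∈ (extChartAt 𝓘(ℝ, E) (φ t y)).source := by
    have h1 : ContinuousAt (extChartAt 𝓘(ℝ, E) y).symm p := continuousAt_extChartAt_symm y
    have h2 : (extChartAt 𝓘(ℝ, E) y).symm p = y := extChartAt_to_inv y
    have h3 : ContinuousAt (φ t) ((extChartAt 𝓘(ℝ, E) y).symm p) := by
      rw [h2]
      exact (mdifferentiableAt_slice hφ htI y).continuousAt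
    refine (h3.comp h1).preimage_mem_nhds ?_
    rw [comp_apply, h2]
    exact extChartAt_source_mem_nhds (φ t y)
  -- The velocity identity is needed in a neighbourhood of `p`, as it is differentiated in `p`.
  have hψV : ∀ᶠ p' in 𝓝 p, fderiv ℝ ψ (t, p') (1, 0) = V (ψ (t, p')) := by
    have hline : Tendsto (fun p' : E => (t, p')) (𝓝 p) (𝓝 (t, p)) :=
      Continuous.tendsto (by fun_prop) p
    filter_upwards [hcont, hline.eventually (eventually_mem_nhds_iff.2 hS')] with p' h1 h2
    have h3 : DifferentiableAt ℝ ψ (t, p') := (hsm.contDiffAt h2).differentiableAt (by simp)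
    have h4 : HasDerivAt (fun s : ℝ => (s, p')) ((1 : ℝ), (0 : E)) t :=
      (hasDerivAt_id t).prodMk (hasDerivAt_const t p')
    have h5 := h3.hasFDerivAt.comp_hasDerivAt t h4
    exact h5.unique (hφV _ h1)
  have hWψ : fderiv ℝ ψ (t, p) (0, w) = W := by
    have h1 := hψs.differentiableAt (by simp) |>.hasFDerivAt.comp p
      (hasFDerivAt_prodMk_right t p)
    have h2 := hasFDerivAt_chartRep (mdifferentiableAt_slice hφ htI y) (mem_extChartAt_source _)
      h1 w
    refine h2.trans (Eq.trans ?_ hW.symm)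
    exact congrArg (fun L : E →L[ℝ] E => L (mfderiv 𝓘(ℝ, E) 𝓘(ℝ, E) (φ t) y w))
      mfderiv_extChartAt_self
  have hmain := hasDerivAt_pullback (Λ := fun q : ℝ × E => (b q.1).inChart (φ t y) q.2)
    (ψ := ψ) (V := V) (t := t) (p := p) (hψtp ▸ hΛ) hψs (hψtp ▸ hV) hψV w
  rw [hψtp, hWψ] at hmain
  refine hmain.congr_of_eventuallyEq ?_
  have hline : Tendsto (fun s : ℝ => (s, p)) (𝓝 t) (𝓝 (t, p)) := Continuous.tendsto (by fun_prop) t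
  filter_upwards [hline.eventually (eventually_mem_nhds_iff.2 hS')] with s hs
  rw [(heq s (mem_of_mem_nhds hs)).2 w b, fderivWithin_of_mem_nhds hs]

end Pullback

/-! ### The infinitesimal identity from a twisted primitive -/

section Twisted

open Filter Topology Function

universe u

variable {E : Type u} [NormedAddCommGroup E] [NormedSpace ℝ E]
  {Y : Type*} [TopologicalSpace Y] [ChartedSpace E Y] [IsManifold 𝓘(ℝ, E) ∞ Y]

theorem OneForm.inChart_self (lam : OneForm E Y) (z : Y) (v : E) :
    lam.inChart z (extChartAt 𝓘(ℝ, E) z z) v = lam z v := by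
  have h1 := mfderiv_extChartAt_symm_self z v
  have h2 : (extChartAt 𝓘(ℝ, E) z).symm (extChartAt 𝓘(ℝ, E) z z) = z := extChartAt_to_inv z
  unfold OneForm.inChart
  rw [h2]
  exact congrArg (lam z) h1

theorem chartConstField_self (z : Y) (v : E) : chartConstField z v z = v :=
  mfderiv_extChartAt_symm_self z v

theorem OneForm.tDeriv_eq_fderiv {b : ℝ → OneForm E Y} {z : Y}
    (hb : ContDiffOn ℝ ∞ (fun q : ℝ × E => (b q.1).inChart z q.2)
      (Icc (0 : ℝ) 1 ×ˢ (extChartAt 𝓘(ℝ, E) z).target)) {t : ℝ} (ht : t ∈ Ioo (0 : ℝ) 1) (v : E) :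
    OneForm.tDeriv b t z v
      = fderiv ℝ (fun q : ℝ × E => (b q.1).inChart z q.2) (t, extChartAt 𝓘(ℝ, E) z z) (1, 0) v := by
  have h1 := ((hb.contDiffAt (prod_mem_nhds (Icc_mem_nhds ht.1 ht.2)
    (extChartAt_target_mem_nhds z))).differentiableAt (by simp)).hasFDerivAt.comp_hasDerivAt t
    ((hasDerivAt_id t).prodMk (hasDerivAt_const t (extChartAt 𝓘(ℝ, E) z z)))
  have h2 := ((ContinuousLinearMap.apply ℝ ℝ v).hasFDerivAt).comp_hasDerivAt t h1
  unfold OneForm.tDeriv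
  rw [derivWithin_of_mem_nhds (Icc_mem_nhds ht.1 ht.2)]
  refine HasDerivAt.deriv (h2.congr_of_eventuallyEq (Eventually.of_forall fun s => ?_))
  exact ((b s).inChart_self z v).symm

theorem HasFDerivAt.hasDerivAt_comp_smulRight {F G : Type*} [NormedAddCommGroup F]
    [NormedSpace ℝ F] [NormedAddCommGroup G] [NormedSpace ℝ G] {f : ℝ → G} {A : F →L[ℝ] G} {v : F}
    {σ : ℝ} (h : HasFDerivAt f (A.comp ((1 : ℝ →L[ℝ] ℝ).smulRight v)) σ) :
    HasDerivAt f (A v) σ :=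
  h.hasDerivAt.congr_deriv (by simp)

omit [IsManifold 𝓘(ℝ, E) ∞ Y] in
/-- The derivative of a function along the flow lines. -/
theorem IsSmoothFlow.hasDerivAt_comp {X : VecField E Y} {Φ : ℝ → Y → Y} (hΦ : IsSmoothFlow X Φ)
    {f : Y → ℝ} {σ : ℝ} {y : Y} (hf : MDifferentiableAt 𝓘(ℝ, E) 𝓘(ℝ, ℝ) f (Φ σ y)) :
    HasDerivAt (fun s => f (Φ s y)) (dirDeriv f (Φ σ y) (X (Φ σ y))) σ := by
  exact HasFDerivAt.hasDerivAt_comp_smulRight (F := E) (G := ℝ)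
    (hf.hasMFDerivAt.comp σ (hΦ.curve y σ)).hasFDerivAt

/-- The velocity of the time flow, in a chart. -/
theorem IsSmoothFlow.hasDerivAt_timeFlow [FiniteDimensional ℝ E] [CompactSpace Y]
    {X : VecField E Y} {Φ : ℝ → Y → Y} (hΦ : IsSmoothFlow X Φ)
    {K : ℝ → Y → ℝ} (hK : SmoothTimeFunction E K) {t : ℝ} (ht : t ∈ Ioo (0 : ℝ) 1) {y z : Y}
    (hz : timeFlow Φ K t y ∈ (extChartAt 𝓘(ℝ, E) z).source) :
    HasDerivAt (fun s => extChartAt 𝓘(ℝ, E) z (timeFlow Φ K s y))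
      (K t (timeFlow Φ K t y) • X.inChart z (extChartAt 𝓘(ℝ, E) z (timeFlow Φ K t y))) t := by
  have hτ := ((hΦ.isScalarSolution hK y).2 t (Ioo_subset_Icc_self ht)).hasDerivAt
    (Icc_mem_nhds ht.1 ht.2)
  rw [VecField.inChart_extChartAt X z hz]
  have h1 : HasMFDerivAt 𝓘(ℝ, E) 𝓘(ℝ, E) (extChartAt 𝓘(ℝ, E) z) (timeFlow Φ K t y)
      (mfderiv 𝓘(ℝ, E) 𝓘(ℝ, E) (extChartAt 𝓘(ℝ, E) z) (timeFlow Φ K t y)) :=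
    (mdifferentiableAt_extChartAt (by rwa [extChartAt_source] at hz)).hasMFDerivAt
  set τ := Classical.epsilon (IsScalarSolution (fun t σ y => K t (Φ σ y)) y) with hτdef
  exact (HasFDerivAt.hasDerivAt_comp_smulRight (F := E) (G := E)
    (HasMFDerivAt.comp (τ t) h1 (hΦ.curve y (τ t))).hasFDerivAt).scomp t hτ

omit [IsManifold 𝓘(ℝ, E) ∞ Y] in
theorem SmoothTimeFunction.mdifferentiableAt {H : ℝ → Y → ℝ} (hH : SmoothTimeFunction E H) {t : ℝ}
    (ht : t ∈ Icc (0 : ℝ) 1) (y : Y) : MDifferentiableAt 𝓘(ℝ, E) 𝓘(ℝ, ℝ) (H t) y := by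
  have : ContMDiffOn 𝓘(ℝ, E) 𝓘(ℝ, ℝ) ∞ (H t) univ :=
    ContMDiffOn.comp (g := fun p : ℝ × Y => H p.1 p.2) hH ((contMDiff_const (c := t)).prodMk contMDiff_id).contMDiffOn
      fun y _ => ⟨ht, mem_univ y⟩
  exact (contMDiffOn_univ.1 this y).mdifferentiableAt (by simp)

omit [IsManifold 𝓘(ℝ, E) ∞ Y] in
theorem SmoothTimeFunction.neg {H : ℝ → Y → ℝ} (hH : SmoothTimeFunction E H) :
    SmoothTimeFunction E (fun t y => - H t y) :=
  (contDiff_neg.contMDiff : ContMDiff 𝓘(ℝ, ℝ) 𝓘(ℝ, ℝ) ∞ (fun x : ℝ => -x)).comp_contMDiffOn hH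

/-- The derivative of `b t` along `X`, computed from a twisted primitive. -/
theorem OneForm.IsTwistedPrimitive.deriv_eq [FiniteDimensional ℝ E] {b : ℝ → OneForm E Y}
    (hb : ∀ z, ContDiffOn ℝ ∞ (fun q : ℝ × E => (b q.1).inChart z q.2)
      (Icc (0 : ℝ) 1 ×ˢ (extChartAt 𝓘(ℝ, E) z).target))
    {X : VecField E Y} (hX : X.SmoothOn univ)
    (hbX : ∀ t ∈ Icc (0 : ℝ) 1, ∀ y, b t y (X y) = 1) {t : ℝ} (ht : t ∈ Ioo (0 : ℝ) 1)
    (hbt : (b t).SmoothOn univ) {h : Y → ℝ}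
    (hh : (b t).IsTwistedPrimitive (b t).kerField h (OneForm.tDeriv b t)) (z : Y) (W : E) :
    fderiv ℝ (fun q : ℝ × E => (b q.1).inChart z q.2) (t, extChartAt 𝓘(ℝ, E) z z) (1, 0) W
      - h z * (fderiv ℝ ((b t).inChart z) (extChartAt 𝓘(ℝ, E) z z) (X z) W
        + b t z (fderiv ℝ (X.inChart z) (extChartAt 𝓘(ℝ, E) z z) W))
      - dirDeriv h z W = - dirDeriv h z (X z) * b t z W := by
  obtain ⟨μ, ⟨-, hμ⟩, hprim⟩ := hh
  have htI : t ∈ Icc (0 : ℝ) 1 := Ioo_subset_Icc_self ht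
  have h1 := hμ _ X (chartConstField z W) (isOpen_extChartAt_source z) (hX.mono (subset_univ _))
    (chartConstField_smoothOn z W) z (mem_extChartAt_source z)
  rw [OneForm.dApply_chartConstField hbt (hbX t htI), hbX t htI, mul_one] at h1
  have h2 : ∀ ν : OneForm E Y, ν z (chartConstField z W z) = ν z W := fun ν =>
    congrArg (ν z) (chartConstField_self z W)
  rw [h2, h2] at h1
  -- `b s (X)` is constantly `1` on `[0, 1]`, so its time derivative is zero.
  have hR : OneForm.tDeriv b t z (X z) = 0 := by
    unfold OneForm.tDeriv
    rw [derivWithin_congr (f := fun _ => (1 : ℝ)) (fun s hs => hbX s hs z) (hbX t htI z)]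
    simp
  set v : E := X z with hv
  have hlin : ∀ ν : E →L[ℝ] ℝ, ν (W - b t z W • v) = ν W - b t z W * ν v := by
    intro ν
    rw [map_sub, map_smul, smul_eq_mul]
  -- `W` is split along `ker b_t ⊕ ℝ X`. The primitive is used on the kernel part, and the multiple
  -- of `X` produces the factor `-dh(X)`.
  have hker : W - b t z W • v ∈ (b t).kerField z := by
    refine (hlin (b t z)).trans (sub_eq_zero.2 ?_)
    exact ((congrArg (fun r => b t z W * r) (hbX t htI z)).trans (mul_one _)).symm
  have h3 := hprim z _ hker
  rw [OneForm.tDeriv_eq_fderiv (hb z) ht] at h3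
  have hR' := (OneForm.tDeriv_eq_fderiv (hb z) ht v).symm.trans hR
  have h4 : dirDeriv h z (W - b t z W • v) = dirDeriv h z W - b t z W * dirDeriv h z v :=
    hlin (mfderiv 𝓘(ℝ, E) 𝓘(ℝ, ℝ) h z)
  have h5 : μ z (W - b t z W • v) = μ z W - b t z W * μ z v := hlin (μ z)
  rw [h4, h5, hlin, hR'] at h3
  rw [h1]
  linear_combination -h3

end Twisted

/-! ### Moser's argument -/

section Isotopy

open Filter Topology Function

/-- A solution of a homogeneous linear equation vanishes at one time if and only if it vanishes at
the initial time. -/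
theorem eq_zero_iff_of_hasDerivAt_mul {u g : ℝ → ℝ} {C : ℝ} (hu : ContinuousOn u (Icc 0 1))
    (hd : ∀ t ∈ Ioo (0 : ℝ) 1, HasDerivAt u (g t * u t) t) (hg : ∀ t ∈ Ioo (0 : ℝ) 1, |g t| ≤ C)
    {t : ℝ} (ht : t ∈ Icc (0 : ℝ) 1) : u t = 0 ↔ u 0 = 0 := by
  -- As `|g| ≤ C`, `u² e^{ks}` is nondecreasing for `k = 2C` and nonincreasing for `k = -2C`. Each
  -- gives one direction, and no regularity of `g` is needed.
  have hder : ∀ k : ℝ, ∀ s ∈ Ioo (0 : ℝ) 1, HasDerivAt (fun s => u s ^ 2 * Real.exp (k * s))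
      ((2 * g s + k) * (u s ^ 2 * Real.exp (k * s))) s := by
    intro k s hs
    have h2 : HasDerivAt (fun s : ℝ => Real.exp (k * s)) (Real.exp (k * s) * k) s := by
      simpa using ((hasDerivAt_id s).const_mul k).exp
    refine (((hd s hs).fun_pow 2).mul h2).congr_deriv ?_
    push_cast
    ring
  have hcont : ∀ k : ℝ, ContinuousOn (fun s => u s ^ 2 * Real.exp (k * s)) (Icc 0 1) := fun k =>
    (hu.pow 2).mul (by fun_prop)
  have hnn : ∀ k s : ℝ, 0 ≤ u s ^ 2 * Real.exp (k * s) := fun k s => by positivity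
  have hzero : ∀ k s : ℝ, u s ^ 2 * Real.exp (k * s) ≤ 0 → u s = 0 := by
    intro k s h
    have := (mul_eq_zero.1 (le_antisymm h (hnn k s))).resolve_right (Real.exp_ne_zero _)
    exact pow_eq_zero_iff two_ne_zero |>.1 this
  have hmono : MonotoneOn (fun s => u s ^ 2 * Real.exp ((2 * C) * s)) (Icc 0 1) := by
    refine monotoneOn_of_deriv_nonneg (convex_Icc 0 1) (hcont _) ?_ ?_ <;> rw [interior_Icc]
    · exact fun s hs => (hder _ s hs).differentiableAt.differentiableWithinAt
    · intro s hs
      rw [(hder _ s hs).deriv]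
      exact mul_nonneg (by linarith [(abs_le.1 (hg s hs)).1]) (hnn _ _)
  have hanti : AntitoneOn (fun s => u s ^ 2 * Real.exp ((-2 * C) * s)) (Icc 0 1) := by
    refine antitoneOn_of_deriv_nonpos (convex_Icc 0 1) (hcont _) ?_ ?_ <;> rw [interior_Icc]
    · exact fun s hs => (hder _ s hs).differentiableAt.differentiableWithinAt
    · intro s hs
      rw [(hder _ s hs).deriv]
      exact mul_nonpos_of_nonpos_of_nonneg (by linarith [(abs_le.1 (hg s hs)).2]) (hnn _ _)
  constructor
  · intro h
    refine hzero (2 * C) 0 ((hmono (by simp) ht ht.1).trans ?_)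
    simp [h]
  · intro h
    refine hzero (-2 * C) t ((hanti (by simp) ht ht.1).trans ?_)
    simp [h]

universe u

variable {E : Type u} [NormedAddCommGroup E] [NormedSpace ℝ E] [FiniteDimensional ℝ E]
  {Y : Type*} [TopologicalSpace Y] [ChartedSpace E Y] [IsManifold 𝓘(ℝ, E) ∞ Y] [CompactSpace Y]
  {X : VecField E Y} {Φ : ℝ → Y → Y}

/-- The derivatives of `H t` along `X` are bounded along the curves of the time flow. -/
theorem IsSmoothFlow.exists_dirDeriv_bound (hΦ : IsSmoothFlow X Φ) {H K : ℝ → Y → ℝ}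
    (hH : SmoothTimeFunction E H) (hK : SmoothTimeFunction E K) (y : Y) :
    ∃ C, ∀ t ∈ Icc (0 : ℝ) 1,
      |dirDeriv (H t) (timeFlow Φ K t y) (X (timeFlow Φ K t y))| ≤ C := by
  obtain ⟨M, hM⟩ := hK.exists_bound
  -- The derivative along `X` is the derivative of `σ ↦ H t (Φ σ y)`, bounded by its Lipschitz
  -- constant. The margin in `M + 1` makes `τ t` an interior point.
  obtain ⟨C, hC⟩ := exists_scalar_lipschitz_point (h := fun t σ y => H t (Φ σ y))
    (hΦ.contMDiffOn_speed hH) y (M + 1)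
  refine ⟨C, fun t ht => ?_⟩
  have hτ := (hΦ.isScalarSolution hK y).abs_le (fun t ht σ y => hM t ht _) t ht
  have hd := hΦ.hasDerivAt_comp (hH.mdifferentiableAt ht (timeFlow Φ K t y))
  refine hd.le_of_lip' C.2 ?_
  have hmem : Icc (-(M + 1)) (M + 1) ∈
      𝓝 (Classical.epsilon (IsScalarSolution (fun t σ y => K t (Φ σ y)) y) t) :=
    Icc_mem_nhds (by linarith [hτ.1]) (by linarith [hτ.2])
  filter_upwards [hmem] with σ hσ
  exact hC t ht σ hσ _ (mem_of_mem_nhds hmem)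

omit [CompactSpace Y] [FiniteDimensional ℝ E] in
theorem VecField.inChart_self (X : VecField E Y) (z : Y) :
    X.inChart z (extChartAt 𝓘(ℝ, E) z z) = X z :=
  (X.inChart_extChartAt z (mem_extChartAt_source z)).trans
    (congrArg (fun L : E →L[ℝ] E => L (X z)) mfderiv_extChartAt_self)

omit [FiniteDimensional ℝ E] in
-- Product rule for the velocity field `V = -h X`: with `λ(X) = 1` the term from differentiating `h`
-- is exactly `-dh`. This matches the transport formula with the left side of
-- `OneForm.IsTwistedPrimitive.deriv_eq`.
theorem transport_algebra {A : ℝ × E →L[ℝ] E →L[ℝ] ℝ} {B : E →L[ℝ] E →L[ℝ] ℝ}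
    (hAB : ∀ v, A (0, v) = B v) {l dh : E →L[ℝ] ℝ} {D : E →L[ℝ] E} {x : E} (hx : l x = 1) (h : ℝ)
    (W : E) :
    A (1, (-h) • x) W + l (((-h) • D + (-dh).smulRight x) W)
      = A (1, 0) W - h * (B x W + l (D W)) - dh W := by
  have h1 : ((1 : ℝ), (-h) • x) = (1, 0) + (-h) • ((0 : ℝ), x) := by simp
  rw [h1, map_add, map_smul, hAB]
  simp [hx]
  ring

/-- The Moser computation: the velocity `-H_t X` cancels `ḃ_t` up to a multiple of `b_t`, so each
value of the pullback solves a homogeneous linear equation in `t`. -/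
theorem IsSmoothFlow.hasDerivAt_pullbackPath (hΦ : IsSmoothFlow X Φ) (hX : X.SmoothOn univ)
    {b : ℝ → OneForm E Y}
    (hb : ∀ z, ContDiffOn ℝ ∞ (fun q : ℝ × E => (b q.1).inChart z q.2)
      (Icc (0 : ℝ) 1 ×ˢ (extChartAt 𝓘(ℝ, E) z).target))
    (hbX : ∀ t ∈ Icc (0 : ℝ) 1, ∀ y, b t y (X y) = 1)
    (hbt : ∀ t ∈ Icc (0 : ℝ) 1, (b t).SmoothOn univ) {H : ℝ → Y → ℝ}
    (hH : SmoothTimeFunction E H)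
    (hprim : ∀ t ∈ Icc (0 : ℝ) 1,
      (b t).IsTwistedPrimitive (b t).kerField (H t) (OneForm.tDeriv b t))
    {t : ℝ} (ht : t ∈ Ioo (0 : ℝ) 1) (y : Y) (w : TangentSpace 𝓘(ℝ, E) y) {z : Y}
    (hz : z = timeFlow Φ (fun t y => - H t y) t y) :
    HasDerivAt (pullbackPath b (timeFlow Φ (fun t y => - H t y)) y w)
      (- dirDeriv (H t) z (X z) * pullbackPath b (timeFlow Φ (fun t y => - H t y)) y w t) t := by
  have htI : t ∈ Icc (0 : ℝ) 1 := Ioo_subset_Icc_self ht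
  subst hz
  set φ := timeFlow Φ (fun t y => - H t y) with hφ
  set z := φ t y with hz
  set c := extChartAt 𝓘(ℝ, E) z with hc
  set W : E := mfderiv 𝓘(ℝ, E) 𝓘(ℝ, E) (φ t) y w with hW
  have hHd := hH.mdifferentiableAt htI z
  have hHc : DifferentiableAt ℝ (fun e => H t (c.symm e)) (c z) := by
    have h1 : MDifferentiableAt 𝓘(ℝ, E) 𝓘(ℝ, E) c.symm (c z) :=
      ((contMDiffOn_extChartAt_symm (n := ∞) z).contMDiffAt
        (extChartAt_target_mem_nhds z)).mdifferentiableAt (by simp)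
    have h2 : c.symm (c z) = z := extChartAt_to_inv z
    have h3 : MDifferentiableAt 𝓘(ℝ, E) 𝓘(ℝ, ℝ) (H t ∘ c.symm) (c z) :=
      MDifferentiableAt.comp (c z) (h2.symm ▸ hHd) h1
    exact h3.differentiableAt
  have hXd : DifferentiableAt ℝ (X.inChart z) (c z) :=
    ((VecField.contDiffOn_inChart hX z).contDiffAt
      (extChartAt_target_mem_nhds z)).differentiableAt (by simp)
  have hzz : c.symm (c z) = z := extChartAt_to_inv z
  obtain ⟨x, hxX⟩ : ∃ x : E, x = X z := ⟨_, rfl⟩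
  have hx : X.inChart z (c z) = x := (X.inChart_self z).trans hxX.symm
  have hV : HasFDerivAt (fun e => (- H t (c.symm e)) • X.inChart z e)
      ((- H t z) • fderiv ℝ (X.inChart z) (c z)
        + (- fderiv ℝ (fun e => H t (c.symm e)) (c z)).smulRight x) (c z) := by
    refine (hHc.hasFDerivAt.neg.smul hXd.hasFDerivAt).congr_fderiv ?_
    rw [hx, Pi.neg_apply, hzz]
  have hmain := _root_.hasDerivAt_pullbackPath hb (hΦ.contMDiffOn_timeFlow hH.neg) ht y w
    (V := fun e => (- H t (c.symm e)) • X.inChart z e) (e := c z) rfl hV.differentiableAt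
    (fun y' hy' => by
      refine (hΦ.hasDerivAt_timeFlow hH.neg ht hy').congr_deriv ?_
      have h := c.left_inv hy'
      rw [h]) hW
  refine hmain.congr_deriv ?_
  have hbX' : (b t).inChart z (c z) x = 1 := by
    rw [hxX]
    exact ((b t).inChart_self z (X z)).trans (hbX t htI z)
  have hAB : ∀ v : E, fderiv ℝ (fun q : ℝ × E => (b q.1).inChart z q.2) (t, c z) (0, v)
      = fderiv ℝ ((b t).inChart z) (c z) v := by
    intro v
    have h1 : DifferentiableAt ℝ (fun q : ℝ × E => (b q.1).inChart z q.2) (t, c z) :=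
      ((hb z).contDiffAt (prod_mem_nhds (Icc_mem_nhds ht.1 ht.2)
        (extChartAt_target_mem_nhds z))).differentiableAt (by simp)
    have h2 := h1.hasFDerivAt.comp (c z) (hasFDerivAt_prodMk_right t (c z))
    exact (congrArg (fun L => L v) h2.fderiv).symm
  have halg := transport_algebra (x := x) hAB hbX' (H t z)
    (dh := fderiv ℝ (fun e => H t (c.symm e)) (c z)) (D := fderiv ℝ (X.inChart z) (c z)) W
  have hVz : (- H t (c.symm (c z))) • X.inChart z (c z) = (- H t z) • x := by
    rw [hzz, hx]
  refine (congrArg₂ (fun (v : E) (D : E →L[ℝ] E) =>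
    fderiv ℝ (fun q : ℝ × E => (b q.1).inChart z q.2) (t, c z) (1, v) W
      + (b t).inChart z (c z) (D W)) hVz hV.fderiv).trans (halg.trans ?_)
  have hdH : fderiv ℝ (fun e => H t (c.symm e)) (c z) W = dirDeriv (H t) z W :=
    (dirDeriv_eq_fderiv hHd W).symm
  have hbW := (b t).inChart_self z (fderiv ℝ (X.inChart z) (c z) W)
  rw [hdH, hbW, hxX]
  exact OneForm.IsTwistedPrimitive.deriv_eq hb hX hbX ht (hbt t htI) (hprim t htI) z W

end Isotopy

/-! ### Kernels along the flow, and the theorem -/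

section Isotopy

open Filter Topology Function

universe u

variable {E : Type u} [NormedAddCommGroup E] [NormedSpace ℝ E] [FiniteDimensional ℝ E]
  {Y : Type*} [TopologicalSpace Y] [ChartedSpace E Y] [IsManifold 𝓘(ℝ, E) ∞ Y]

theorem OneForm.SmoothPath.contDiffOn_inChart_const_add {lam : OneForm E Y}
    (hlam : lam.SmoothOn univ) {β : ℝ → OneForm E Y} (hβ : OneForm.SmoothPath β) (z : Y) :
    ContDiffOn ℝ ∞ (fun q : ℝ × E => (lam + β q.1).inChart z q.2)
      (Icc (0 : ℝ) 1 ×ˢ (extChartAt 𝓘(ℝ, E) z).target) := by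
  refine ((hlam.smoothPath.contDiffOn_inChart z).add (hβ.contDiffOn_inChart z)).congr fun q _ => ?_
  exact ContinuousLinearMap.add_comp _ _ _

variable [CompactSpace Y] {X : VecField E Y} {Φ : ℝ → Y → Y}

/-- The time flow of `- H t • X` pulls back the kernel of `b t` to the kernel of `b 0`. -/
theorem IsSmoothFlow.comap_kerField (hΦ : IsSmoothFlow X Φ) (hX : X.SmoothOn univ)
    {b : ℝ → OneForm E Y}
    (hb : ∀ z, ContDiffOn ℝ ∞ (fun q : ℝ × E => (b q.1).inChart z q.2)
      (Icc (0 : ℝ) 1 ×ˢ (extChartAt 𝓘(ℝ, E) z).target))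
    (hbX : ∀ t ∈ Icc (0 : ℝ) 1, ∀ y, b t y (X y) = 1)
    (hbt : ∀ t ∈ Icc (0 : ℝ) 1, (b t).SmoothOn univ) {H : ℝ → Y → ℝ}
    (hH : SmoothTimeFunction E H)
    (hprim : ∀ t ∈ Icc (0 : ℝ) 1,
      (b t).IsTwistedPrimitive (b t).kerField (H t) (OneForm.tDeriv b t))
    {t : ℝ} (ht : t ∈ Icc (0 : ℝ) 1) (y : Y) (w : TangentSpace 𝓘(ℝ, E) y) :
    mfderiv 𝓘(ℝ, E) 𝓘(ℝ, E) (timeFlow Φ (fun t y => - H t y) t) y w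
      ∈ (b t).kerField (timeFlow Φ (fun t y => - H t y) t y) ↔ w ∈ (b 0).kerField y := by
  set φ := timeFlow Φ (fun t y => - H t y) with hφ
  obtain ⟨C, hC⟩ := hΦ.exists_dirDeriv_bound hH hH.neg y
  have h1 := eq_zero_iff_of_hasDerivAt_mul
    (continuousOn_pullbackPath hb (hΦ.contMDiffOn_timeFlow hH.neg) y w)
    (fun s hs => hΦ.hasDerivAt_pullbackPath hX hb hbX hbt hH hprim hs y w rfl)
    (fun s hs => by rw [abs_neg]; exact hC s (Ioo_subset_Icc_self hs)) ht
  refine Iff.trans h1 ?_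
  have h0 : φ 0 = id := funext fun y => hΦ.timeFlow_zero hH.neg y
  have h2 : pullbackPath b φ y w 0 = b 0 y w := by
    unfold pullbackPath
    rw [h0]
    exact congrArg (fun L : E →L[ℝ] E => b 0 y (L w)) (mfderiv_id (I := 𝓘(ℝ, E)) (x := y))
  rw [h2]
  rfl

end Isotopy

theorem mainTheorem7
    {E : Type*} [NormedAddCommGroup E] [NormedSpace ℝ E] [FiniteDimensional ℝ E]
    {Y : Type*} [TopologicalSpace Y] [ChartedSpace E Y] [IsManifold 𝓘(ℝ, E) ∞ Y]
    [T2Space Y] [CompactSpace Y]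
    (F : ℝ → PlaneField E Y)
    (hF : ∀ t ∈ Icc (0 : ℝ) 1, (F t).IsCodimOneFoliation)
    (L : PlaneField E Y) (hL : L.IsSmoothLineField)
    (hLF : ∀ y, IsCompl (L y) (F 0 y))
    (lam : OneForm E Y) (β : ℝ → OneForm E Y)
    (hβ : OneForm.SmoothPath β) (hβ0 : β 0 = 0)
    (hβL : ∀ t ∈ Icc (0 : ℝ) 1, ∀ y, ∀ w ∈ L y, β t y w = 0)
    (hlam : ∀ t ∈ Icc (0 : ℝ) 1, (lam + β t).Defines (F t))
    (hex : ∃ H : ℝ → Y → ℝ, SmoothTimeFunction E H ∧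
      ∀ t ∈ Icc (0 : ℝ) 1, (lam + β t).IsTwistedPrimitive (F t) (H t)
        (OneForm.tDeriv (fun s => lam + β s) t)) :
    IsIsotopyOfFoliations F := by
  obtain ⟨H, hH, hprim⟩ := hex
  have : CompleteSpace E := FiniteDimensional.complete ℝ E
  have hF' : ∀ t ∈ Icc (0 : ℝ) 1, F t = (lam + β t).kerField := fun t ht =>
    funext fun y => (hlam t ht).ker_eq y
  have hI0 : (0 : ℝ) ∈ Icc (0 : ℝ) 1 := by simp
  have hlam0 : lam.SmoothOn univ := by
    have := (hlam 0 hI0).smooth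
    rwa [hβ0, add_zero] at this
  have hF0 : F 0 = lam.kerField := by rw [hF' 0 hI0, hβ0, add_zero]
  obtain ⟨R, hR, hRL⟩ := hL.exists_normalized_section hlam0 fun y => by
    rw [← hF0]
    exact (hLF y).disjoint
  obtain ⟨Φ, hΦ⟩ := VecField.exists_isSmoothFlow hR
  -- Since `β_t` vanishes on `L`, one field `R` normalizes every `λ_t`. This is why the motion can
  -- follow a single autonomous flow.
  have hbR : ∀ t ∈ Icc (0 : ℝ) 1, ∀ y, (lam + β t) y (R y) = 1 := by
    intro t ht y
    refine (_root_.add_apply (lam y) (β t y) (R y)).trans ?_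
    rw [(hRL y).2, hβL t ht y _ (hRL y).1, add_zero]
  obtain ⟨φ, hφ⟩ : ∃ φ : ℝ → Diffeomorph 𝓘(ℝ, E) 𝓘(ℝ, E) Y Y ∞, ∀ t ∈ Icc (0 : ℝ) 1,
      (φ t : Y → Y) = timeFlow Φ (fun t y => - H t y) t := by
    classical
    -- Outside `[0, 1]` the diffeomorphism is irrelevant and is set to the identity.
    refine ⟨fun t => if ht : t ∈ Icc (0 : ℝ) 1 then hΦ.timeDiffeo hH.neg ht
      else Diffeomorph.refl _ _ _, fun t ht => ?_⟩
    simp only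
    split
    · rfl
    · contradiction
  refine ⟨φ, ?_, fun y => ?_, fun t ht y => ?_⟩
  · exact (hΦ.contMDiffOn_timeFlow hH.neg).congr fun p hp => congrFun (hφ p.1 hp.1) p.2
  · rw [hφ 0 hI0]
    exact hΦ.timeFlow_zero hH.neg y
  · ext w
    have hker := hΦ.comap_kerField hR (b := fun s => lam + β s)
      (OneForm.SmoothPath.contDiffOn_inChart_const_add hlam0 hβ) hbR
      (fun t ht => (hlam t ht).smooth) hH (fun t ht => hF' t ht ▸ hprim t ht) ht y w
    rw [← hφ t ht] at hker
    rw [hF' t ht, hF' 0 hI0]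
    exact hker
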